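/- \textbf{Matching Test.} There is a randomized algorithm with oracle access to two strings $X, Y$ over an arbitrary alphabet which satisfy $|Y| = |X| + 2K$ for an integer $K \ge 0$, and which is additionally given $|X|$, $K$, a sampling rate $r > 0$ and an error parameter $\delta \in (0,1)$, such that the following holds. For $s \in \{-K, \dots, K\}$ let $Y_s$ be the substring of $Y$ of length $|X|$ with indices $K+s, \dots, |X|+K+s-1$ (indices start at zero), and let $\mathrm{HD}(A,B)$ denote the Hamming distance of two strings of equal length, i.e. the number of positions where they differ. The algorithm returns one of the following two outputs: \begin{itemize} \item $\textsc{Close}(s^*)$, where $s^* \in \{-K, \dots, K\}$ satisfies $\mathrm{HD}(X, Y_{s^*}) \le 1/r$; \item $\textsc{Far}$, in which case there is no $s^* \in \{-K, \dots, K\}$ with $X = Y_{s^*}$. \end{itemize} For every input, the algorithm always runs in time $O(r |X| \log(1/\delta) + K \log(|X|+1) + 1)$, with an absolute constant, and its output is correct with probability at least $1 - \delta$. Here the model is the word RAM in which the two strings can be accessed only by testing two of their characters for equality, a uniformly random element of $\{0, \dots, m-1\}$ can be drawn in one step for any word $m \geq 1$, and the real parameters are presented as fractions $a/b$ and $c/d$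 of nonnegative integers with positive denominators, $r \le a/b \le 2r$ and $\delta^2 \le c/d \le \delta$ (so $a/b = r$ and $c/d = \delta$ is allowed). The words may have any number $w \ge \kappa \log_2(|X| + 2K + a + b + c + d)$ of bits, where $\kappa$ is an absolute constant. -/

import Mathlib

/-! ## Strings, shifts, and the promise of the test

A string of length `n` over `α` is a function `Fin n → α`; its Hamming distance is Mathlib's
`hammingDist`. -/

/-- For `|Y| = n + 2K` and a shift `s ∈ {-K, …, K}`: the substring of `Y` with the indices
`K + s, …, n + K + s - 1` (indices start at zero). -/
def window {α : Type*} {n K : ℕ} (Y : Fin (n + 2 * K) → α) (s : Set.Icc (-(K : ℤ)) (K : ℤ)) :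
    Fin n → α :=
  fun i => Y ⟨((K : ℤ) + (s : ℤ) + (i : ℕ)).toNat, by
    have h1 := s.2.1
    have h2 := s.2.2
    have h3 := i.2
    omega⟩

/-- The two possible answers of the test: `Close[s]` and `Far`. -/
inductive Answer where
  | close (s : ℤ)
  | far

/-- When an answer is correct for the strings `X`, `Y` and the rate `r`. -/
def Answer.Correct {α : Type*} [DecidableEq α] {n K : ℕ} (X : Fin n → α)
    (Y : Fin (n + 2 * K) → α) (r : ℝ) : Answer → Prop
  | .close s => ∃ hs : s ∈ Set.Icc (-(K : ℤ)) (K : ℤ),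
      (hammingDist X (window Y ⟨s, hs⟩) : ℝ) ≤ 1 / r
  | .far => ¬ ∃ s : Set.Icc (-(K : ℤ)) (K : ℤ), X = window Y s

/-! ## A randomized word RAM with oracle access to two strings

The machine has registers and a random access memory, all holding `w`-bit words, and is programmed
by finite structured programs. Every instruction takes one step. The two strings
are read-only and are accessed only by comparing two of their characters for equality,
so that the alphabet is arbitrary. -/

namespace WordRAM

/-- Arithmetic and comparison of words. -/
inductive BinOp where
  | add | sub | mul | div | mod | lt | eq

/-- Value of an operation before reduction to a word; comparisons give `1` or `0`, subtraction is
truncated at `0`, and `x / 0 = 0`, `x % 0 = x`. -/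
def BinOp.eval : BinOp → ℕ → ℕ → ℕ
  | .add, x, y => x + y
  | .sub, x, y => x - y
  | .mul, x, y => x * y
  | .div, x, y => x / y
  | .mod, x, y => x % y
  | .lt, x, y => if x < y then 1 else 0
  | .eq, x, y => if x = y then 1 else 0

/-- Which of the two input strings is accessed. -/
inductive Str where
  | X | Y

/-- Unit-cost instructions. Arguments that are natural numbers are names of registers, except for
the constant `k` in `const`. -/
inductive Instr where
  /-- `dst := k` -/
  | const (dst k : ℕ)
  /-- `dst := x ∘ y` -/
  | arith (o : BinOp) (dst x y : ℕ)
  /-- `dst := memory[addr]` -/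
  | load (dst addr : ℕ)
  /-- `memory[addr] := src` -/
  | store (addr src : ℕ)
  /-- `dst := 1` if the character of `S` at position `i` equals the one of `T` at position `j`,
  and `dst := 0` otherwise -/
  | cmp (dst : ℕ) (S : Str) (i : ℕ) (T : Str) (j : ℕ)
  /-- `dst :=` a fresh uniformly random element of `{0, …, m - 1}`, where `m` is the content
  of the register `bound` (`dst := 0` if `m = 0`) -/
  | rand (dst bound : ℕ)

/-- Programs. `branch x p q` runs `p` if the register `x` is nonzero and `q` otherwise;
`loop x p` runs `p` as long as `x` is nonzero. -/
inductive Program where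
  | instr (i : Instr)
  | seq (p q : Program)
  | branch (x : ℕ) (p q : Program)
  | loop (x : ℕ) (p : Program)

/-- Contents of the registers and of the memory. -/
structure State where
  reg : ℕ → ℕ
  mem : ℕ → ℕ

/-- Write `v`, reduced to a `w`-bit word, to the register `dst`. -/
def State.setReg (w : ℕ) (σ : State) (dst v : ℕ) : State :=
  { σ with reg := Function.update σ.reg dst (v % 2 ^ w) }

/-- Write `v`, reduced to a `w`-bit word, to the memory cell `addr`. -/
def State.setMem (w : ℕ) (σ : State) (addr v : ℕ) : State :=
  { σ with mem := Function.update σ.mem addr (v % 2 ^ w) }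

/-- The uniform distribution on `{0, …, m - 1}` (the point mass at `0` if `m = 0`). -/
noncomputable def uniformBelow : ℕ → PMF ℕ
  | 0 => PMF.pure 0
  | m + 1 => (PMF.uniformOfFintype (Fin (m + 1))).map (fun i => (i : ℕ))

section Semantics

variable {α : Type*} [DecidableEq α] {n m : ℕ}

/-- The character at position `i`; `none` beyond the end of the string. -/
def charAt (X : Fin n → α) (Y : Fin m → α) : Str → ℕ → Option α
  | .X, i => if h : i < n then some (X ⟨i, h⟩) else none
  | .Y, i => if h : i < m then some (Y ⟨i, h⟩) else none

/-- Execution of one instruction. -/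
noncomputable def Instr.exec (w : ℕ) (X : Fin n → α) (Y : Fin m → α) (σ : State) :
    Instr → PMF State
  | .const dst k => PMF.pure (σ.setReg w dst k)
  | .arith o dst x y => PMF.pure (σ.setReg w dst (o.eval (σ.reg x) (σ.reg y)))
  | .load dst addr => PMF.pure (σ.setReg w dst (σ.mem (σ.reg addr)))
  | .store addr src => PMF.pure (σ.setMem w (σ.reg addr) (σ.reg src))
  | .cmp dst S i T j => PMF.pure (σ.setReg w dst
      (if charAt X Y S (σ.reg i) = charAt X Y T (σ.reg j) then 1 else 0))
  | .rand dst bound => (uniformBelow (σ.reg bound)).map (fun v => σ.setReg w dst v)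

/-- A configuration: the list of program parts that remain to be run, and the state. The machine
has halted when nothing remains to be run. -/
abbrev Config := List Program × State

/-- One step of the machine; a halted configuration does not change. -/
noncomputable def step (w : ℕ) (X : Fin n → α) (Y : Fin m → α) : Config → PMF Config
  | ([], σ) => PMF.pure ([], σ)
  | (.instr i :: rest, σ) => (i.exec w X Y σ).map (fun σ' => (rest, σ'))
  | (.seq p q :: rest, σ) => PMF.pure (p :: q :: rest, σ)
  | (.branch x p q :: rest, σ) => PMF.pure (if σ.reg x ≠ 0 then p :: rest else q :: rest, σ)
  | (.loop x p :: rest, σ) =>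
      PMF.pure (if σ.reg x ≠ 0 then p :: .loop x p :: rest else rest, σ)

/-- Distribution of the configuration after `t` steps. -/
noncomputable def run (w : ℕ) (X : Fin n → α) (Y : Fin m → α) : ℕ → Config → PMF Config
  | 0, c => PMF.pure c
  | t + 1, c => (step w X Y c).bind (run w X Y t)

end Semantics

/-- Initial state: the numbers of the list `input` in the registers `0, 1, 2, …`, and `0` in all
other registers and in the whole memory. -/
def init (w : ℕ) (input : List ℕ) : State where
  reg i := input.getD i 0 % 2 ^ w
  mem _ := 0

/-- How the answer of the matching test is read off the final state: `Far` if register `0` is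
`0`, and otherwise `Close[s]`, where `s + K` is the content of register `1`. -/
def answer (K : ℕ) (σ : State) : Answer :=
  if σ.reg 0 = 0 then .far else .close ((σ.reg 1 : ℤ) - (K : ℤ))

end WordRAM

/-! ### Program logic: running time and success probability together -/

namespace WordRAM

/-! It suffices to treat `r = a / b` and `δ = c / d` exactly, since a correct answer for the larger
rate and the smaller error is correct for the given ones. If `a * n ≤ b`, every shift has at most `1
/ r` mismatches and any may be returned. Otherwise let `m = min n (4 * K)`, and count shifts from
`0` to `2 * K`. In the manner of Knuth, Morris and Pratt, the smallest periods of the prefixes of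
`X` give the first position `t ≤ 2 * K` where the prefix of length `m` occurs in `Y`. Without one
there is no exact match, and for `n ≤ 4 * K` an occurrence is an exact match.

For `n > 4 * K` the shift `t` is tested at random positions; more than `1 / r` mismatches stay
unnoticed with probability at most `δ ^ 3` (`sampleBound`). If a mismatch shows up, `t` is not an
exact match. Let `p` be the smallest period of the prefix of length `4 * K`. Occurrences of this
prefix differ by periods, so for `p > 2 * K` no other shift remains and the answer is `Far`. For `p
≤ 2 * K` every exact match differs from `t` by a multiple of `p` (`IsMinPer.dvd`). At the mismatch,
`X` or the shifted `Y` leaves the `p`-periodic pattern. Binary search finds such a break `l`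
preceded by `2 * K` regular positions, and advancing the shift until `Y` breaks at `u + l` leaves
`u` as the only possible exact match (`eq_of_occursAt_of_break`). A second sampled test decides
between `Close` at `u` and `Far`.

Two tests succeed with probability at least `(1 - δ ^ 3) ^ 2`, which exceeds `1 - δ` for `δ < 2 / 3`
but not for `δ` near `1`. There a fair coin replaces the second test, as one of the two answers is
right (`mul_finalProb_ge`). The sample size needs a rational substitute for `log (1 / δ)` that is
sharp up to a constant even as `δ` tends to `1` (`log_le_logBound`, `logBound_le`).

`Good` bounds time and success probability at once. `RunsTo` is in continuation style, so that
deterministic pieces can be put in front of anything random. -/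

theorem pmf_bind_congr {α β : Type*} (p : PMF α) {f g : α → PMF β}
    (h : ∀ a ∈ p.support, f a = g a) : p.bind f = p.bind g := by
  ext b
  simp only [PMF.bind_apply]
  refine tsum_congr fun a => ?_
  by_cases ha : a ∈ p.support
  · rw [h a ha]
  · rw [(PMF.apply_eq_zero_iff p a).2 ha, zero_mul, zero_mul]

/-- Write `v` to the register `d`, without reduction. -/
def State.set (σ : State) (d v : ℕ) : State :=
  { σ with reg := Function.update σ.reg d v }

/-- Write `v` to the memory cell `i`, without reduction. -/
def State.put (σ : State) (i v : ℕ) : State :=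
  { σ with mem := Function.update σ.mem i v }

theorem State.set_reg (σ : State) (d v r : ℕ) :
    (σ.set d v).reg r = if r = d then v else σ.reg r := by
  simp [State.set, Function.update_apply]

theorem State.set_reg_ne (σ : State) (d v r : ℕ) (h : r ≠ d) :
    (σ.set d v).reg r = σ.reg r := by
  simp [State.set, h]

theorem State.set_mem (σ : State) (d v : ℕ) : (σ.set d v).mem = σ.mem := rfl

theorem State.put_reg (σ : State) (d v : ℕ) : (σ.put d v).reg = σ.reg := rfl

theorem State.put_mem (σ : State) (d v r : ℕ) :
    (σ.put d v).mem r = if r = d then v else σ.mem r := by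
  simp [State.put, Function.update_apply]

theorem State.setReg_eq_set {w : ℕ} {v : ℕ} (σ : State) (d : ℕ) (h : v < 2 ^ w) :
    σ.setReg w d v = σ.set d v := by
  simp [State.setReg, State.set, Nat.mod_eq_of_lt h]

theorem State.setMem_eq_put {w : ℕ} {v : ℕ} (σ : State) (d : ℕ) (h : v < 2 ^ w) :
    σ.setMem w d v = σ.put d v := by
  simp [State.setMem, State.put, Nat.mod_eq_of_lt h]

section

variable {α : Type*} [DecidableEq α] {n m : ℕ} {w : ℕ} {X : Fin n → α} {Y : Fin m → α}
  {S : Set State}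

theorem run_nil (t : ℕ) (σ : State) : run w X Y t ([], σ) = PMF.pure ([], σ) := by
  induction t with
  | zero => rfl
  | succ t ih => simp [run, step, ih]

theorem run_add_of_halted (s : ℕ) : ∀ (t : ℕ) (c : Config),
    (∀ cfg ∈ (run w X Y t c).support, cfg.1 = []) → run w X Y (t + s) c = run w X Y t c := by
  intro t
  induction t with
  | zero =>
    rintro ⟨l, σ⟩ h
    have : l = [] := h (l, σ) (by simp [run])
    subst this
    rw [run_nil, run_nil]
  | succ t ih =>
    intro c h
    rw [Nat.succ_add_eq_add_succ, Nat.add_succ]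
    show (step w X Y c).bind _ = (step w X Y c).bind _
    refine pmf_bind_congr _ fun c' hc' => ih c' fun cfg hcfg => h cfg ?_
    simp only [run, PMF.mem_support_bind_iff]
    exact ⟨c', hc', hcfg⟩

/-- From `c` the machine always halts within `T` steps, and its final state is in `S` with
probability at least `q`. -/
def Good (w : ℕ) (X : Fin n → α) (Y : Fin m → α) (S : Set State) (T : ℕ) (q : ℝ)
    (c : Config) : Prop :=
  (∀ cfg ∈ (run w X Y T c).support, cfg.1 = []) ∧
    ENNReal.ofReal q ≤ (run w X Y T c).toOuterMeasure {cfg | cfg.2 ∈ S}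

/-- A wrong final state is admitted with the guarantee `q = 0`; this allows the values of outcomes
to be indicators. -/
theorem Good.halt {σ : State} {q : ℝ} (T : ℕ) (hq : q ≤ 1) (h : 0 < q → σ ∈ S) :
    Good w X Y S T q ([], σ) := by
  rw [Good, run_nil]
  refine ⟨by simp, ?_⟩
  rcases lt_or_ge 0 q with h0 | h0
  · rw [PMF.toOuterMeasure_pure_apply, if_pos (by exact h h0)]
    exact ENNReal.ofReal_le_one.2 hq
  · simp [ENNReal.ofReal_of_nonpos h0]

theorem Good.mono {T T' : ℕ} {q q' : ℝ} {c : Config} (h : Good w X Y S T q c) (hT : T ≤ T')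
    (hq : q' ≤ q) : Good w X Y S T' q' c := by
  obtain ⟨s, rfl⟩ := Nat.exists_eq_add_of_le hT
  rw [Good, run_add_of_halted s T c h.1]
  exact ⟨h.1, (ENNReal.ofReal_le_ofReal hq).trans h.2⟩

theorem Good.of_step {T : ℕ} {q : ℝ} {c c' : Config} (hs : step w X Y c = PMF.pure c')
    (h : Good w X Y S T q c') : Good w X Y S (T + 1) q c := by
  rw [Good, run, hs, PMF.pure_bind]
  exact h

/-- Law of total probability: the guarantees after the individual outcomes are averaged. They must
be nonnegative because `ENNReal.ofReal` cuts off at zero and is additive only there. -/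
theorem Good.rand {T : ℕ} {q : ℕ → ℝ} {σ : State} {rest : List Program} {dst bound : ℕ}
    (hb : 0 < σ.reg bound) (hw : σ.reg bound ≤ 2 ^ w) (hq : ∀ i < σ.reg bound, 0 ≤ q i)
    (h : ∀ i < σ.reg bound, Good w X Y S T (q i) (rest, σ.set dst i)) :
    Good w X Y S (T + 1) ((∑ i ∈ Finset.range (σ.reg bound), q i) / σ.reg bound)
      (.instr (.rand dst bound) :: rest, σ) := by
  obtain ⟨M, hM⟩ := Nat.exists_eq_succ_of_ne_zero hb.ne'
  have key : run w X Y (T + 1) (.instr (.rand dst bound) :: rest, σ) =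
      (PMF.uniformOfFintype (Fin (M + 1))).bind
        fun i => run w X Y T (rest, σ.set dst i) := by
    rw [run, step, Instr.exec, hM]
    simp only [uniformBelow, PMF.map_comp, PMF.bind_map]
    refine (PMF.bind_bind (PMF.uniformOfFintype (Fin (M + 1)))
      (fun i => PMF.pure (i : ℕ)) _).trans ?_
    simp only [PMF.pure_bind, Function.comp]
    refine congrArg _ (funext fun i => ?_)
    rw [State.setReg_eq_set]
    have := i.2
    omega
  rw [hM] at hq h
  rw [Good, key, hM]
  constructor
  · intro cfg hcfg
    rw [PMF.mem_support_bind_iff] at hcfg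
    obtain ⟨i, -, hi⟩ := hcfg
    exact (h i i.2).1 cfg hi
  · rw [PMF.toOuterMeasure_bind_apply, tsum_fintype]
    simp only [PMF.uniformOfFintype_apply, Fintype.card_fin]
    rw [← Finset.mul_sum, div_eq_inv_mul, ENNReal.ofReal_mul (by positivity),
      Finset.sum_range, ENNReal.ofReal_sum_of_nonneg fun (i : Fin (M + 1)) _ => hq i i.2]
    refine mul_le_mul' (le_of_eq ?_) (Finset.sum_le_sum fun (i : Fin (M + 1)) _ => (h i i.2).2)
    rw [ENNReal.ofReal_inv_of_pos (by positivity), ENNReal.ofReal_natCast]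

/-- From the state `σ`, the program `p` takes at most `t` steps and ends in a state with `Post`. -/
def RunsTo (w : ℕ) (X : Fin n → α) (Y : Fin m → α) (p : Program) (σ : State) (t : ℕ)
    (Post : State → Prop) : Prop :=
  ∀ (S : Set State) (T : ℕ) (q : ℝ) (rest : List Program),
    (∀ σ', Post σ' → Good w X Y S T q (rest, σ')) → Good w X Y S (T + t) q (p :: rest, σ)

variable {σ : State} {t : ℕ} {Post : State → Prop}

theorem RunsTo.mono {p : Program} {t' : ℕ} {Post' : State → Prop}
    (h : RunsTo w X Y p σ t Post) (ht : t ≤ t') (hP : ∀ σ', Post σ' → Post' σ') :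
    RunsTo w X Y p σ t' Post' := fun S T q rest hr =>
  (h S T q rest fun σ' hσ' => hr σ' (hP σ' hσ')).mono (by omega) le_rfl

theorem RunsTo.seq {p p' : Program} {t' : ℕ}
    (h : RunsTo w X Y p σ t fun σ' => RunsTo w X Y p' σ' t' Post) :
    RunsTo w X Y (.seq p p') σ (t + t' + 1) Post := by
  intro S T q rest hr
  rw [← add_assoc]
  refine Good.of_step rfl ?_
  rw [add_comm t, ← add_assoc]
  exact h S _ q _ fun σ' hσ' => hσ' S T q rest hr

theorem RunsTo.branch {x : ℕ} {p p' : Program}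
    (h1 : σ.reg x ≠ 0 → RunsTo w X Y p σ t Post) (h0 : σ.reg x = 0 → RunsTo w X Y p' σ t Post) :
    RunsTo w X Y (.branch x p p') σ (t + 1) Post := by
  intro S T q rest hr
  rw [← add_assoc]
  refine Good.of_step rfl ?_
  split_ifs with hx
  · exact h1 hx S T q rest hr
  · exact h0 (not_not.1 hx) S T q rest hr

/-- The index of the invariant is a potential. It may drop by more than one per round, as happens
when a candidate period or occurrence jumps ahead. -/
theorem RunsTo.loop {x : ℕ} {p : Program} (Inv : ℕ → State → Prop)
    (hb : ∀ k σ, Inv k σ → σ.reg x ≠ 0 → RunsTo w X Y p σ t fun σ' => ∃ k' < k, Inv k' σ') :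
    ∀ k σ, Inv k σ → RunsTo w X Y (.loop x p) σ ((k + 1) * (t + 1))
      fun σ' => σ'.reg x = 0 ∧ ∃ k', Inv k' σ' := by
  intro k
  induction k using Nat.strong_induction_on with
  | _ k ih =>
    intro σ hσ S T q rest hr
    rw [Nat.add_one_mul, ← add_assoc, ← add_assoc]
    refine Good.of_step rfl ?_
    split_ifs with hx
    · refine hb k σ hσ hx S (T + k * (t + 1)) q (.loop x p :: rest) ?_
      rintro σ' ⟨k', hk', hI⟩
      exact (ih k' hk' σ' hI S T q rest hr).mono
        (by
          have := Nat.mul_le_mul_right (t + 1) (Nat.succ_le_of_lt hk')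
          rw [Nat.succ_eq_add_one] at this
          omega) le_rfl
    · exact (hr σ ⟨not_not.1 hx, k, hσ⟩).mono (by omega) le_rfl

/-- Run the instruction `i` and then the list `l` of instructions. -/
def block (i : Instr) : List Instr → Program
  | [] => .instr i
  | j :: l => .seq (.instr i) (block j l)

/-- Weakest precondition of a list of instructions without `rand`, for executions without
overflow. -/
def wp (w : ℕ) (X : Fin n → α) (Y : Fin m → α) (Post : State → Prop) : List Instr → State → Prop
  | [], σ => Post σ
  | .const d k :: l, σ => k < 2 ^ w ∧ wp w X Y Post l (σ.set d k)
  | .arith o d x y :: l, σ =>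
      o.eval (σ.reg x) (σ.reg y) < 2 ^ w ∧ wp w X Y Post l (σ.set d (o.eval (σ.reg x) (σ.reg y)))
  | .load d a :: l, σ => σ.mem (σ.reg a) < 2 ^ w ∧ wp w X Y Post l (σ.set d (σ.mem (σ.reg a)))
  | .store a s :: l, σ => σ.reg s < 2 ^ w ∧ wp w X Y Post l (σ.put (σ.reg a) (σ.reg s))
  | .cmp d A i B j :: l, σ => 1 < 2 ^ w ∧ wp w X Y Post l
      (σ.set d (if charAt X Y A (σ.reg i) = charAt X Y B (σ.reg j) then 1 else 0))
  | .rand _ _ :: _, _ => False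

theorem RunsTo.instr {i : Instr} (h : wp w X Y Post [i] σ) :
    RunsTo w X Y (.instr i) σ 1 Post := by
  intro S T q rest hr
  obtain ⟨σ', hσ', hs⟩ : ∃ σ', Post σ' ∧ i.exec w X Y σ = PMF.pure σ' := by
    cases i with
    | const d k => exact ⟨_, h.2, by rw [Instr.exec, State.setReg_eq_set _ _ h.1]⟩
    | arith o d x y => exact ⟨_, h.2, by rw [Instr.exec, State.setReg_eq_set _ _ h.1]⟩
    | load d a => exact ⟨_, h.2, by rw [Instr.exec, State.setReg_eq_set _ _ h.1]⟩
    | store a s => exact ⟨_, h.2, by rw [Instr.exec, State.setMem_eq_put _ _ h.1]⟩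
    | cmp d A i B j =>
      refine ⟨_, h.2, ?_⟩
      rw [Instr.exec, State.setReg_eq_set]
      have := h.1
      split_ifs <;> omega
    | rand d b => exact h.elim
  refine Good.of_step ?_ (hr σ' hσ')
  rw [step, hs, PMF.pure_map]

theorem wp_cons {i : Instr} {l : List Instr} (h : wp w X Y Post (i :: l) σ) :
    wp w X Y (fun σ' => wp w X Y Post l σ') [i] σ := by
  cases i <;> exact h

theorem RunsTo.block {l : List Instr} : ∀ {i : Instr} {σ : State}, wp w X Y Post (i :: l) σ →
    RunsTo w X Y (block i l) σ (2 * l.length + 1) Post := by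
  induction l with
  | nil => exact fun h => RunsTo.instr h
  | cons j l ih =>
    intro i σ h
    refine (RunsTo.seq ((RunsTo.instr (wp_cons h)).mono le_rfl fun σ' hσ' => ih hσ')).mono
      (by simp only [List.length_cons]; omega) fun _ h => h

end

end WordRAM

/-! ## Periods and occurrences -/

section Strings

variable {β : Type*}

/-- `c` is a period of the prefix of length `L` of `x`. -/
def IsPer (x : ℕ → β) (c L : ℕ) : Prop := ∀ k, k + c < L → x (k + c) = x k

/-- `c` is the smallest positive period of the prefix of length `L` of `x`. -/
def IsMinPer (x : ℕ → β) (c L : ℕ) : Prop :=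
  1 ≤ c ∧ IsPer x c L ∧ ∀ e, 1 ≤ e → e < c → ¬ IsPer x e L

/-- The prefix of length `L` of `x` occurs in `y` at position `c`. -/
def OccursAt (x y : ℕ → β) (c L : ℕ) : Prop := ∀ k < L, y (c + k) = x k

variable {x y : ℕ → β} {c p L : ℕ}

theorem IsPer.anti {L' : ℕ} (h : IsPer x c L) (hL : L' ≤ L) : IsPer x c L' :=
  fun k hk => h k (hk.trans_le hL)

/-- The empty prefix gets period `1`, so that a jump by a stored period always makes progress. -/
theorem isMinPer_zero : IsMinPer x 1 0 :=
  ⟨le_rfl, fun k hk => by omega, fun _ h1 h2 => by omega⟩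

theorem IsMinPer.le (h : IsMinPer x p L) : p ≤ L + 1 := by
  by_contra hp
  exact h.2.2 (L + 1) (by omega) (by omega) fun k hk => by omega

/-- Extending a period by a letter. -/
theorem IsPer.succ {i : ℕ} (h : IsPer x c i) (hx : i < c ∨ x i = x (i - c)) :
    IsPer x c (i + 1) := by
  intro k hk
  rcases Nat.lt_succ_iff_lt_or_eq.1 hk with hk | hk
  · exact h k hk
  · rcases hx with hx | hx
    · omega
    · rw [hk, hx]
      congr 1
      omega

/-- The periodicity failing at a letter, the next candidate for a period of the prefix. -/
theorem isPer_next {i : ℕ} (hci : c ≤ i) (hx : x i ≠ x (i - c)) (h : IsPer x c i)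
    (hno : ∀ e, 1 ≤ e → e < c → ¬ IsPer x e (i + 1)) (hp : IsMinPer x p (i - c)) :
    IsPer x (c + p) i ∧ ∀ e, 1 ≤ e → e < c + p → ¬ IsPer x e (i + 1) := by
  constructor
  · intro k hk
    rw [show k + (c + p) = k + p + c by omega, h (k + p) (by omega), hp.2.1 k (by omega)]
  · intro e he1 he hper
    rcases lt_trichotomy e c with h1 | rfl | h1
    · exact hno e he1 h1 hper
    · have := hper (i - e) (by omega)
      rw [Nat.sub_add_cancel hci] at this
      exact hx this
    · refine hp.2.2 (e - c) (by omega) (by omega) fun k hk => ?_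
      have h2 := hper k (by omega)
      have h3 := h (k + (e - c)) (by omega)
      rw [show k + (e - c) + c = k + e by omega] at h3
      rw [← h3, h2]

/-- The letter after a partial occurrence not matching, the next candidate for an occurrence. -/
theorem occursAt_next {j : ℕ} (hcj : c ≤ j) (hx : y j ≠ x (j - c)) (hj : j < c + L)
    (h : ∀ k, c + k < j → y (c + k) = x k) (hno : ∀ e < c, ¬ OccursAt x y e L)
    (hp : IsMinPer x p (j - c)) :
    (∀ k, c + p + k < j → y (c + p + k) = x k) ∧ ∀ e < c + p, ¬ OccursAt x y e L := by
  constructor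
  · intro k hk
    rw [show c + p + k = c + (k + p) by omega, h (k + p) (by omega), hp.2.1 k (by omega)]
  · intro e he hocc
    rcases lt_trichotomy e c with h1 | rfl | h1
    · exact hno e h1 hocc
    · have := hocc (j - e) (by omega)
      rw [Nat.add_sub_cancel' hcj] at this
      exact hx this
    · refine hp.2.2 (e - c) (by omega) (by omega) fun k hk => ?_
      have h2 := hocc k (by omega)
      have h3 := h (k + (e - c)) (by omega)
      rw [show c + (k + (e - c)) = e + k by omega] at h3
      rw [← h3, h2]

/-- The smallest period divides every other period, if the string is long enough. -/
theorem IsMinPer.dvd (hp : IsMinPer x p L) : ∀ {q : ℕ}, IsPer x q L → p + q ≤ L → p ∣ q := by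
  intro q
  induction q using Nat.strong_induction_on with
  | _ q ih =>
    intro hq hL
    rcases Nat.eq_zero_or_pos q with rfl | hq0
    · exact dvd_zero p
    have hpq : p ≤ q := by
      by_contra hlt
      exact hp.2.2 q hq0 (by omega) hq
    have h1 := hp.1
    -- Euclid by subtraction: `q - p` is again a period.
    have : p ∣ q - p := by
      refine ih (q - p) (by omega) (fun k hk => ?_) (by omega)
      by_cases hkp : p ≤ k
      · have h2 := hp.2.1 (k - p) (by omega)
        have h3 := hq (k - p) (by omega)
        rw [Nat.sub_add_cancel hkp] at h2
        rw [show k - p + q = k + (q - p) by omega] at h3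
        rw [h3, h2]
      -- For `k < p` one cannot step back by `p`, so the step goes forward through `k + q`, which is
      -- inside the prefix because `p + q ≤ L`.
      · have h2 := hp.2.1 (k + (q - p)) (by omega)
        have h3 := hq k (by omega)
        rw [show k + (q - p) + p = k + q by omega] at h2
        rw [← h2, h3]
    have := Nat.dvd_add this (dvd_refl p)
    rwa [Nat.sub_add_cancel hpq] at this

theorem IsPer.eq_mod (h : IsPer x p L) : ∀ {i : ℕ}, i < L → x i = x (i % p) := by
  intro i
  induction i using Nat.strong_induction_on with
  | _ i ih =>
    intro hi
    rcases Nat.eq_zero_or_pos p with rfl | hp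
    · simp
    by_cases hip : p ≤ i
    · have h2 := h (i - p) (by omega)
      rw [Nat.sub_add_cancel hip] at h2
      rw [h2, ih (i - p) (by omega) (by omega), ← Nat.mod_eq_sub_mod hip]
    · rw [Nat.mod_eq_of_lt (by omega)]

/-- The difference of two occurrences is a period. -/
theorem OccursAt.isPer_sub {t u : ℕ} (ht : OccursAt x y t L) (hu : OccursAt x y u L)
    (htu : t ≤ u) : IsPer x (u - t) L := by
  intro k hk
  rw [← ht _ hk, ← hu k (by omega)]
  congr 1
  omega

/-- Position `i` of `x` and position `t + i` of `y` both follow the `p`-periodic extension of the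
prefix of `x`. -/
def Follows (x y : ℕ → β) (p t i : ℕ) : Prop := x i = x (i % p) ∧ y (t + i) = x (i % p)

theorem follows_of_lt {t i : ℕ} (hp : IsPer x p L) (ht : OccursAt x y t L) (hi : i < L) :
    Follows x y p t i :=
  ⟨hp.eq_mod hi, by rw [ht i hi, hp.eq_mod hi]⟩

/-- Around a break of periodicity, the shift is determined. -/
theorem eq_of_occursAt_of_break {M n t u s l : ℕ} (hp : IsMinPer x p (2 * M)) (hpM : p ≤ M)
    (ht : OccursAt x y t (2 * M)) (hmin : ∀ e < t, ¬ OccursAt x y e (2 * M))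
    (_hn : 2 * M ≤ n) (hl : 2 * M ≤ l) (hln : l < n)
    (hblock : ∀ i, l ≤ i + M → i < l → Follows x y p t i) (hbreak : ¬ Follows x y p t l)
    (htu : t ≤ u) (hscan : ∀ v, t ≤ v → v < u → y (v + l) = x ((v - t + l) % p))
    (hlast : u = M ∨ y (u + l) ≠ x ((u - t + l) % p))
    (hs : OccursAt x y s n) (hsM : s ≤ M) : s = u := by
  have hs' : OccursAt x y s (2 * M) := fun k hk => hs k (by omega)
  have hts : t ≤ s := by
    by_contra h
    exact hmin s (by omega) hs'
  -- Both `p` and `s - t` are at most `M`, which is why a prefix of length `2 * M` is used.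
  have hdvd : p ∣ s - t := hp.dvd (ht.isPer_sub hs' hts) (by omega)
  obtain ⟨g, hg⟩ := hdvd
  -- Before reaching `s`, the scan reads letters of `Y` which the match at `s` identifies with
  -- letters of `X` among the `M` regular ones before `l`. Hence it cannot stop before `s`.
  have hgood : ∀ v, t ≤ v → v < s → y (v + l) = x ((v - t + l) % p) := by
    intro v hv1 hv2
    have h1 := (hblock (l - (s - v)) (by omega) (by omega)).1
    rw [show v + l = s + (l - (s - v)) by omega, hs _ (by omega), h1]
    rw [show v - t + l = l - (s - v) + p * g by omega, Nat.add_mul_mod_self_left]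
  rcases lt_trichotomy s u with h | h | h
  -- If the scan went past `s`, then `Y` would be regular at `s + l` and at `t + l`. The first makes
  -- `X` regular at `l`, so `l` would not be a break.
  · exfalso
    have h1 : x l = x (l % p) := by
      have := hscan s hts h
      rwa [hs l hln, hg, show p * g + l = l + p * g by omega, Nat.add_mul_mod_self_left] at this
    refine hbreak ⟨h1, ?_⟩
    have := hscan t le_rfl (by omega)
    rwa [Nat.sub_self, zero_add] at this
  · exact h
  · exfalso
    rcases hlast with h1 | h1
    · omega
    · exact h1 (hgood u htu h)

end Strings

/-! ### Exact search for a prefix of `X` in `Y` -/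

namespace WordRAM

/-- The registers that keep the input, the constants `1` and `2 * K`, and the length `m` of the
prefix of `X` that is searched exactly. -/
structure Env (n K a b c d m : ℕ) (σ : State) : Prop where
  h0 : σ.reg 0 = n
  h1 : σ.reg 1 = K
  h2 : σ.reg 2 = a
  h3 : σ.reg 3 = b
  h4 : σ.reg 4 = c
  h5 : σ.reg 5 = d
  h6 : σ.reg 6 = 1
  h7 : σ.reg 7 = 2 * K
  h8 : σ.reg 8 = m

variable {n K a b c d m : ℕ} {σ : State}

theorem Env.set {r v : ℕ} (h : Env n K a b c d m σ) (hr : 9 ≤ r) :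
    Env n K a b c d m (σ.set r v) := by
  obtain ⟨h0, h1, h2, h3, h4, h5, h6, h7, h8⟩ := h
  constructor <;> rw [State.set_reg_ne _ _ _ _ (by omega)] <;> assumption

theorem Env.put {i v : ℕ} (h : Env n K a b c d m σ) : Env n K a b c d m (σ.put i v) := by
  obtain ⟨h0, h1, h2, h3, h4, h5, h6, h7, h8⟩ := h
  constructor <;> assumption

/-- Computes the smallest periods of all prefixes of length at most `m` of `X`. -/
def periodsProgram : Program :=
  .seq (block (.const 13 0) [.const 14 1, .store 13 14, .arith .lt 15 13 8])
    (.loop 15 (.seq (block (.arith .lt 16 13 14)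
      [.arith .sub 17 13 14, .cmp 18 .X 13 .X 17, .arith .add 16 16 18])
      (.seq (.branch 16 (block (.arith .add 13 13 6) [.store 13 14])
        (block (.load 18 17) [.arith .add 14 14 18]))
        (block (.arith .lt 15 13 8) []))))

/-- Searches for the first occurrence at a position `≤ 2 * K` of the prefix of length `m` of `X`
in `Y`. -/
def searchProgram : Program :=
  .seq (block (.const 13 0) [.const 10 0, .arith .add 16 10 8, .arith .lt 15 13 16,
      .arith .lt 17 7 10, .arith .sub 17 6 17, .arith .mul 15 15 17])
    (.loop 15 (.seq (block (.arith .lt 16 13 10)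
      [.arith .sub 17 13 10, .cmp 18 .Y 13 .X 17, .arith .add 16 16 18])
      (.seq (.branch 16 (block (.arith .add 13 13 6) [])
        (block (.load 18 17) [.arith .add 10 10 18]))
        (block (.arith .add 16 10 8) [.arith .lt 15 13 16,
          .arith .lt 17 7 10, .arith .sub 17 6 17, .arith .mul 15 15 17]))))

variable {α : Type*} [DecidableEq α] {N N' w : ℕ} {X : Fin N → α} {Y : Fin N' → α}

/-- Each round either confirms the candidate period for one more letter or replaces it by a larger
one (`isPer_next`). The sum of position and candidate grows every time and stays linear in `m`. -/
theorem runsTo_periods (hm : 2 * m + 4 < 2 ^ w) (hE : Env n K a b c d m σ) :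
    RunsTo w X Y periodsProgram σ (40 * (m + 1)) fun σ' =>
      Env n K a b c d m σ' ∧ ∀ l ≤ m, IsMinPer (charAt X Y .X) (σ'.mem l) l := by
  set x := charAt X Y .X with hx
  let Inv : ℕ → State → Prop := fun k σ => ∃ i c', Env n K a b c d m σ ∧
    σ.reg 13 = i ∧ σ.reg 14 = c' ∧ σ.reg 15 = (if i < m then 1 else 0) ∧ 1 ≤ c' ∧ c' ≤ i + 1 ∧
    i ≤ m ∧ k + (i + c') = 2 * m + 1 ∧
    (∀ l ≤ i, IsMinPer x (σ.mem l) l) ∧ IsPer x c' i ∧ ∀ e, 1 ≤ e → e < c' → ¬ IsPer x e (i + 1)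
  refine (RunsTo.seq (t := 7) (t' := (2 * m + 1) * 15) ?_).mono (by omega) fun _ h => h
  refine (RunsTo.block (Post := Inv (2 * m)) ?_).mono le_rfl fun σ hσ =>
    (RunsTo.loop Inv (t := 14) ?_ _ _ hσ).mono le_rfl ?_
  · simp only [wp, State.set_reg, State.put_reg, BinOp.eval, Nat.reduceEqDiff, reduceIte, hE.h8]
    refine ⟨by omega, by omega, by omega, by split_ifs <;> omega, 0, 1,
      (((hE.set (by omega)).set (by omega)).put).set (by omega), ?_⟩
    simp only [State.set_reg, State.put_reg, State.set_mem, State.put_mem,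
      Nat.reduceEqDiff, reduceIte]
    refine ⟨trivial, trivial, trivial, by omega, by omega, by omega, trivial, fun l hl => ?_,
      fun k hk => by omega, fun e h1 h2 => by omega⟩
    rw [if_pos (by omega), Nat.le_zero.1 hl]
    exact isMinPer_zero
  · rintro k σ ⟨i, c', hE, h13, h14, h15, hc1, hci, him, hk, hmem, hper, hno⟩ hne
    have him' : i < m := by
      by_contra h
      rw [h15, if_neg h] at hne
      exact hne rfl
    refine (RunsTo.seq (t := 7) (t' := 6) ?_).mono (by norm_num) fun _ h => h
    refine (RunsTo.block ?_).mono (by simp) fun _ h => h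
    simp only [wp, State.set_reg, BinOp.eval, Nat.reduceEqDiff, reduceIte, h13, h14, ← hx]
    refine ⟨by split_ifs <;> omega, by omega, by omega, by split_ifs <;> omega, ?_⟩
    refine (RunsTo.seq (t := 4) (t' := 1) ?_).mono (by norm_num) fun _ h => h
    refine RunsTo.branch (t := 3) (fun h16 => ?_) (fun h16 => ?_)
    · simp only [State.set_reg, Nat.reduceEqDiff, reduceIte] at h16
      -- Register `16` adds the two indicators. For `i < c'` truncated subtraction compares with
      -- letter `0`, but the sum is nonzero anyway.
      have hcase : i < c' ∨ x i = x (i - c') := by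
        by_contra! h
        rw [if_neg (by omega), if_neg h.2] at h16
        exact h16 rfl
      refine (RunsTo.block ?_).mono (by simp) fun _ h => h
      simp only [wp, State.set_reg, BinOp.eval, Nat.reduceEqDiff, reduceIte, h13, h14, hE.h6]
      refine ⟨by omega, by omega, ?_⟩
      refine (RunsTo.block ?_).mono (by simp) fun _ h => h
      simp only [wp, State.set_reg, State.put_reg, BinOp.eval,
        Nat.reduceEqDiff, reduceIte, h13, hE.h8]
      refine ⟨by split_ifs <;> omega, k - 1, by omega, i + 1, c', ?_⟩
      simp only [State.set_reg, State.put_reg, State.set_mem, State.put_mem,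
        Nat.reduceEqDiff, reduceIte, h13, h14]
      refine ⟨?_, trivial, trivial, trivial, by omega, by omega, by omega, by omega, fun l hl => ?_,
        hper.succ hcase, fun e h1 h2 h => hno e h1 h2 (h.anti (by omega))⟩
      · repeat' first | exact hE | refine Env.set ?_ (by omega) | refine Env.put ?_
      · split_ifs with hl'
        · rw [hl']
          exact ⟨hc1, hper.succ hcase, hno⟩
        · exact hmem l (by omega)
    · simp only [State.set_reg, Nat.reduceEqDiff, reduceIte] at h16
      have hcase : c' ≤ i ∧ x i ≠ x (i - c') := by
        by_contra! h
        by_cases h' : c' ≤ i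
        · rw [if_pos (h h')] at h16
          omega
        · rw [if_pos (by omega)] at h16
          omega
      have hp := hmem (i - c') (by omega)
      have hp1 := hp.1
      have hp2 := hp.le
      have hnext := isPer_next hcase.1 hcase.2 hper hno hp
      refine (RunsTo.block ?_).mono (by simp) fun _ h => h
      simp only [wp, State.set_reg, State.set_mem, BinOp.eval, Nat.reduceEqDiff, reduceIte, h14]
      refine ⟨by omega, by omega, ?_⟩
      refine (RunsTo.block ?_).mono (by simp) fun _ h => h
      simp only [wp, State.set_reg, BinOp.eval, Nat.reduceEqDiff, reduceIte, h13, hE.h8]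
      refine ⟨by split_ifs; omega, k - σ.mem (i - c'), by omega, i, c' + σ.mem (i - c'), ?_⟩
      simp only [State.set_reg, State.set_mem, Nat.reduceEqDiff, reduceIte, h13, h14]
      refine ⟨?_, trivial, trivial, trivial, by omega, by omega, by omega, by omega, hmem,
        hnext.1, hnext.2⟩
      repeat' first | exact hE | refine Env.set ?_ (by omega)
  · rintro σ ⟨h0, k, i, c', hE, h13, h14, h15, hc1, hci, him, hk, hmem, hper, hno⟩
    refine ⟨hE, fun l hl => hmem l ?_⟩
    by_contra h
    rw [h15, if_pos (by omega)] at h0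
    exact one_ne_zero h0

/-- The same amortization, with `occursAt_next` for the jumps. A final value above `2 * K` encodes
that no admissible occurrence exists. -/
theorem runsTo_search (hm : 4 * (m + 2 * K) + 4 < 2 ^ w) (hE : Env n K a b c d m σ)
    (hper : ∀ l ≤ m, IsMinPer (charAt X Y .X) (σ.mem l) l) :
    RunsTo w X Y searchProgram σ (40 * (m + 4 * K + 2)) fun σ' =>
      Env n K a b c d m σ' ∧ σ'.mem = σ.mem ∧ ∃ t, σ'.reg 10 = t ∧ t < 2 ^ w ∧
        (∀ e < t, ¬ OccursAt (charAt X Y .X) (charAt X Y .Y) e m) ∧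
        (t ≤ 2 * K → OccursAt (charAt X Y .X) (charAt X Y .Y) t m) := by
  set x := charAt X Y .X with hx
  set y := charAt X Y .Y with hy
  set f := σ.mem with hf
  -- The potential is a truncated difference, since the last jump may overshoot; it is positive
  -- while the loop runs, where `j < c' + m` and `c' ≤ 2 * K`.
  let Inv : ℕ → State → Prop := fun k σ => ∃ j c', Env n K a b c d m σ ∧ σ.mem = f ∧
    σ.reg 13 = j ∧ σ.reg 10 = c' ∧
    σ.reg 15 = (if j < c' + m then 1 else 0) * (1 - if 2 * K < c' then 1 else 0) ∧ c' ≤ j + 1 ∧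
    j ≤ c' + m ∧ c' ≤ 2 * K + m + 1 ∧ k = 4 * K + m - (j + c') ∧
    (∀ i, c' + i < j → y (c' + i) = x i) ∧ ∀ e < c', ¬ OccursAt x y e m
  refine (RunsTo.seq (t := 13) (t' := (4 * K + m + 1) * 23) ?_).mono (by omega) fun _ h => h
  refine (RunsTo.block (Post := Inv (4 * K + m)) ?_).mono le_rfl fun σ hσ =>
    (RunsTo.loop Inv (t := 22) ?_ _ _ hσ).mono le_rfl ?_
  · simp only [wp, State.set_reg, BinOp.eval, Nat.reduceEqDiff, reduceIte, hE.h8, hE.h6, hE.h7]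
    refine ⟨by omega, by omega, by omega, by split_ifs <;> omega, by split_ifs <;> omega,
      by split_ifs <;> omega, by split_ifs <;> omega, 0, 0, ?_⟩
    simp only [State.set_reg, State.set_mem, Nat.reduceEqDiff, reduceIte]
    refine ⟨?_, rfl, trivial, trivial, trivial, by omega, by omega, by omega, by omega,
      fun i hi => by omega, fun e h1 => by omega⟩
    repeat' first | exact hE | refine Env.set ?_ (by omega)
  · rintro k σ ⟨j, c', hE, hmem, h13, h10, h15, hci, hjm, hcm, hk, hocc, hno⟩ hne
    have hrun : j < c' + m ∧ c' ≤ 2 * K := by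
      by_contra! h
      refine hne ?_
      rw [h15]
      by_cases hj : j < c' + m
      · simp [hj, h hj]
      · simp [hj]
    refine (RunsTo.seq (t := 7) (t' := 14) ?_).mono (by norm_num) fun _ h => h
    refine (RunsTo.block ?_).mono (by simp) fun _ h => h
    simp only [wp, State.set_reg, BinOp.eval, Nat.reduceEqDiff, reduceIte, h13, h10, ← hx, ← hy]
    refine ⟨by split_ifs <;> omega, by omega, by omega, by split_ifs <;> omega, ?_⟩
    refine (RunsTo.seq (t := 4) (t' := 9) ?_).mono (by norm_num) fun _ h => h
    refine RunsTo.branch (t := 3) (fun h16 => ?_) (fun h16 => ?_)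
    · simp only [State.set_reg, Nat.reduceEqDiff, reduceIte] at h16
      have hcase : j < c' ∨ y j = x (j - c') := by
        by_contra! h
        rw [if_neg (by omega), if_neg h.2] at h16
        exact h16 rfl
      refine (RunsTo.block ?_).mono (by simp) fun _ h => h
      simp only [wp, State.set_reg, BinOp.eval, Nat.reduceEqDiff, reduceIte, h13, hE.h6]
      refine ⟨by omega, ?_⟩
      refine (RunsTo.block ?_).mono (by simp) fun _ h => h
      simp only [wp, State.set_reg, BinOp.eval,
        Nat.reduceEqDiff, reduceIte, h13, h10, hE.h6, hE.h7, hE.h8]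
      refine ⟨by omega, by split_ifs <;> omega, by split_ifs <;> omega,
        by split_ifs <;> omega, by split_ifs <;> omega, k - 1, by omega, j + 1, c', ?_⟩
      simp only [State.set_reg, State.set_mem, Nat.reduceEqDiff, reduceIte, h13, h10]
      refine ⟨?_, hmem, trivial, trivial, trivial, by omega, by omega, by omega, by omega,
        fun i hi => ?_, hno⟩
      · repeat' first | exact hE | refine Env.set ?_ (by omega)
      · rcases Nat.lt_succ_iff_lt_or_eq.1 hi with hi | hi
        · exact hocc i hi
        · rcases hcase with h | h
          · omega
          · rw [hi, h]
            congr 1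
            omega
    · simp only [State.set_reg, Nat.reduceEqDiff, reduceIte] at h16
      have hcase : c' ≤ j ∧ y j ≠ x (j - c') := by
        by_contra! h
        by_cases h' : c' ≤ j
        · rw [if_pos (h h')] at h16
          omega
        · rw [if_pos (by omega)] at h16
          omega
      have hp := hper (j - c') (by omega)
      have hp1 := hp.1
      have hp2 := hp.le
      have hnext := occursAt_next hcase.1 hcase.2 hrun.1 hocc hno hp
      refine (RunsTo.block ?_).mono (by simp) fun _ h => h
      simp only [wp, State.set_reg, State.set_mem, BinOp.eval,
        Nat.reduceEqDiff, reduceIte, h10, hmem]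
      refine ⟨by omega, by omega, ?_⟩
      refine (RunsTo.block ?_).mono (by simp) fun _ h => h
      simp only [wp, State.set_reg, BinOp.eval,
        Nat.reduceEqDiff, reduceIte, h13, h10, hE.h6, hE.h7, hE.h8]
      refine ⟨by omega, by split_ifs <;> omega, by split_ifs <;> omega, by split_ifs <;> omega,
        by split_ifs <;> omega, k - f (j - c'), by omega, j, c' + f (j - c'), ?_⟩
      simp only [State.set_reg, State.set_mem, Nat.reduceEqDiff, reduceIte, h13, h10]
      refine ⟨?_, hmem, trivial, trivial, trivial, by omega, by omega, by omega, by omega,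
        hnext.1, hnext.2⟩
      repeat' first | exact hE | refine Env.set ?_ (by omega)
  · rintro σ ⟨h0, k, j, c', hE, hmem, h13, h10, h15, hci, hjm, hcm, hk, hocc, hno⟩
    refine ⟨hE, hmem, c', h10, by omega, hno, fun hc i hi => hocc i ?_⟩
    by_contra hlt
    rw [h15, if_pos (by omega), if_neg (by omega)] at h0
    omega

/-! ### Finding a break of periodicity and the only remaining shift -/

variable {n K a b c d m : ℕ} {σ : State}

theorem Env.of_eq {σ' : State} (h : Env n K a b c d m σ) (hr : ∀ r < 9, σ'.reg r = σ.reg r) :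
    Env n K a b c d m σ' := by
  obtain ⟨h0, h1, h2, h3, h4, h5, h6, h7, h8⟩ := h
  constructor <;> rw [hr _ (by omega)] <;> assumption

/-- Runs over a block of `2 * K` positions up to the first one where `Follows` fails. -/
def checkLoop : Program :=
  .loop 24 (block (.arith .lt 24 23 21) [.arith .mod 25 23 11, .cmp 26 .X 23 .X 25,
    .arith .add 27 10 23, .cmp 28 .Y 27 .X 25, .arith .mul 24 24 26, .arith .mul 24 24 28,
    .arith .add 23 23 24])

/-- Binary search for a position where `Follows` fails after a block of `2 * K` positions
where it holds. -/
def breakProgram : Program :=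
  .seq (block (.arith .mul 17 8 6) [.arith .add 18 14 6, .arith .add 20 17 6,
      .arith .lt 19 20 18])
    (.loop 19 (.seq (block (.arith .add 21 17 18)
        [.const 22 2, .arith .div 21 21 22, .arith .sub 23 21 7, .const 24 1])
      (.seq checkLoop (.seq (block (.arith .lt 24 23 21) [])
        (.seq (.branch 24 (block (.arith .mul 18 21 6) []) (block (.arith .mul 17 21 6) []))
          (block (.arith .add 20 17 6) [.arith .lt 19 20 18]))))))

/-- Moves the candidate shift forward until the break of `X` meets a break of `Y`. -/
def scanProgram : Program :=
  .seq (block (.arith .mul 20 10 6) [.const 24 1])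
    (.seq (.loop 24 (block (.arith .lt 24 20 7) [.arith .sub 25 20 10, .arith .add 25 25 17,
      .arith .mod 25 25 11, .arith .add 26 20 17, .cmp 27 .Y 26 .X 25, .arith .mul 24 24 27,
      .arith .add 20 20 24]))
    (block (.arith .mul 10 20 6) []))

variable {α : Type*} [DecidableEq α] {N N' w : ℕ} {X : Fin N → α} {Y : Fin N' → α}

theorem runsTo_check {p t mid s : ℕ} (hw : t + mid + 2 < 2 ^ w) (h10 : σ.reg 10 = t)
    (h11 : σ.reg 11 = p) (h21 : σ.reg 21 = mid) (h23 : σ.reg 23 = s) (h24 : σ.reg 24 = 1)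
    (hs : s ≤ mid) :
    RunsTo w X Y checkLoop σ ((mid - s + 2) * 16) fun σ' =>
      (∀ r < 23, σ'.reg r = σ.reg r) ∧ ∃ i, σ'.reg 23 = i ∧ s ≤ i ∧ i ≤ mid ∧
        (∀ j, s ≤ j → j < i → Follows (charAt X Y .X) (charAt X Y .Y) p t j) ∧
        (i < mid → ¬ Follows (charAt X Y .X) (charAt X Y .Y) p t i) := by
  set x := charAt X Y .X with hx
  set y := charAt X Y .Y with hy
  -- The flag `g` is part of the potential, so that the round which only clears it counts as
  -- progress.
  let Inv : ℕ → State → Prop := fun k τ => (∀ r < 23, τ.reg r = σ.reg r) ∧ ∃ i g,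
    τ.reg 23 = i ∧ τ.reg 24 = g ∧ s ≤ i ∧ i ≤ mid ∧ k = mid - i + g ∧
    (∀ j, s ≤ j → j < i → Follows x y p t j) ∧ (g = 0 → i < mid → ¬ Follows x y p t i)
  refine (RunsTo.loop Inv (t := 15) ?_ (mid - s + 1) σ ?_).mono (by omega) ?_
  · rintro k τ ⟨hfr, i, g, h23', h24', hsi, him, hk, hgood, hbad⟩ hne
    refine (RunsTo.block ?_).mono (by simp) fun _ h => h
    simp only [wp, State.set_reg, BinOp.eval,
      Nat.reduceEqDiff, reduceIte, h23', h24', hfr 21 (by omega), hfr 10 (by omega),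
      hfr 11 (by omega),
      h21, h11, h10, ← hx, ← hy]
    have hmod : i % p ≤ i := Nat.mod_le _ _
    have hframe : ∀ (τ' : State), (∀ r < 23, τ'.reg r = τ.reg r) →
        ∀ r < 23, τ'.reg r = σ.reg r := fun τ' h r hr => (h r hr).trans (hfr r hr)
    have hg : g ≠ 0 := by rwa [h24'] at hne
    by_cases h1 : i < mid
    · by_cases h2 : Follows x y p t i
      · simp only [if_pos h1, if_pos h2.1, if_pos h2.2]
        refine ⟨by omega, by omega, by omega, by omega, by omega, by omega, by omega, by omega,
          k - g, by omega, hframe _ fun r hr => ?_, i + 1, 1, ?_⟩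
        · simp (disch := omega) only [State.set_reg_ne]
        · simp only [State.set_reg, Nat.reduceEqDiff, reduceIte]
          refine ⟨trivial, trivial, by omega, by omega, by omega, fun j hj1 hj2 => ?_,
            fun h => h.elim⟩
          rcases Nat.lt_succ_iff_lt_or_eq.1 hj2 with hj | rfl
          · exact hgood j hj1 hj
          · exact h2
      · have h3 : ((if x i = x (i % p) then 1 else 0) *
            if y (t + i) = x (i % p) then 1 else 0) = 0 := by
          by_cases h4 : x i = x (i % p)
          · rw [if_neg fun h5 => h2 ⟨h4, h5⟩, mul_zero]
          · rw [if_neg h4, zero_mul]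
        simp only [if_pos h1, one_mul, h3]
        refine ⟨by omega, by omega, by omega, by omega, by omega,
          by split_ifs <;> omega, by omega, by omega,
          k - g, by omega, hframe _ fun r hr => ?_, i, 0, ?_⟩
        · simp (disch := omega) only [State.set_reg_ne]
        · simp only [State.set_reg, Nat.reduceEqDiff, reduceIte]
          exact ⟨by omega, trivial, by omega, by omega, by omega, hgood, fun _ _ => h2⟩
    · simp only [if_neg h1, zero_mul]
      refine ⟨by omega, by omega, by omega, by omega, by omega,
        by omega, by omega, by omega, k - g, by omega, hframe _ fun r hr => ?_, i, 0, ?_⟩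
      · simp (disch := omega) only [State.set_reg_ne]
      · simp only [State.set_reg, Nat.reduceEqDiff, reduceIte]
        exact ⟨by omega, trivial, by omega, by omega, by omega, hgood, fun _ h => absurd h h1⟩
  · exact ⟨fun _ _ => rfl, s, 1, h23, h24, by omega, by omega, by omega, fun j h1 h2 => by omega,
      by omega⟩
  · rintro τ ⟨h0, k, hfr, i, g, h23', h24', hsi, him, hk, hgood, hbad⟩
    exact ⟨hfr, i, h23', hsi, him, hgood, hbad (h24'.symm.trans h0)⟩

/-- Regularity is not monotone in the position, so the bisection is on blocks: the `2 * K` positions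
before `lo` are regular, those before `hi` contain a break. Each of the logarithmically many rounds
inspects one block. -/
theorem runsTo_break {p t i₀ : ℕ} (hw : 2 * (t + n) + 4 < 2 ^ w) (hE : Env n K a b c d m σ)
    (h10 : σ.reg 10 = t) (h11 : σ.reg 11 = p) (h14 : σ.reg 14 = i₀) (hmi : m ≤ i₀) (hi : i₀ < n)
    (hK : 1 ≤ K) (hmK : 2 * K ≤ m)
    (hfol : ∀ i < m, Follows (charAt X Y .X) (charAt X Y .Y) p t i)
    (hnot : ¬ Follows (charAt X Y .X) (charAt X Y .Y) p t i₀) :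
    RunsTo w X Y breakProgram σ ((Nat.log 2 n + 3) * (40 * (K + 2))) fun σ' =>
      (∀ r < 17, σ'.reg r = σ.reg r) ∧ ∃ l, σ'.reg 17 = l ∧ m ≤ l ∧ l < n ∧
        (∀ i, l ≤ i + 2 * K → i < l → Follows (charAt X Y .X) (charAt X Y .Y) p t i) ∧
        ¬ Follows (charAt X Y .X) (charAt X Y .Y) p t l := by
  set F := Follows (charAt X Y .X) (charAt X Y .Y) p t with hF
  let Inv : ℕ → State → Prop := fun k τ => (∀ r < 17, τ.reg r = σ.reg r) ∧ ∃ lo hi,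
    τ.reg 17 = lo ∧ τ.reg 18 = hi ∧ τ.reg 19 = (if lo + 1 < hi then 1 else 0) ∧ m ≤ lo ∧
    lo < hi ∧ hi ≤ n ∧ hi - lo ≤ 2 ^ k ∧ (∀ i, lo ≤ i + 2 * K → i < lo → F i) ∧
    ∃ i, hi ≤ i + 2 * K ∧ i < hi ∧ ¬ F i
  refine (RunsTo.seq (t := 7) (t' := (Nat.log 2 n + 2) * (32 * (K + 1) + 23 + 1)) ?_).mono (by
    have h1 : (Nat.log 2 n + 3) * (40 * (K + 2)) =
      (Nat.log 2 n + 2) * (40 * (K + 2)) + 40 * (K + 2) := by ring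
    have h2 := Nat.mul_le_mul_left (Nat.log 2 n + 2)
      (show 32 * (K + 1) + 23 + 1 ≤ 40 * (K + 2) by omega)
    omega) fun _ h => h
  refine (RunsTo.block (Post := Inv (Nat.log 2 n + 1)) ?_).mono le_rfl fun τ hτ =>
    (RunsTo.loop Inv (t := 32 * (K + 1) + 23) ?_ _ _ hτ).mono le_rfl ?_
  · simp only [wp, State.set_reg, BinOp.eval,
      Nat.reduceEqDiff, reduceIte, hE.h8, hE.h6, h14, mul_one]
    refine ⟨by omega, by omega, by omega, by split_ifs <;> omega, fun r hr => ?_, m, i₀ + 1, ?_⟩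
    · simp (disch := omega) only [State.set_reg_ne]
    · simp only [State.set_reg, Nat.reduceEqDiff, reduceIte]
      refine ⟨trivial, trivial, trivial, by omega, by omega, by omega, ?_,
        fun i _ => hfol i, i₀, by omega, by omega, hnot⟩
      -- The initial interval has length at most `n`, which is below `2 ^ (Nat.log 2 n + 1)`.
      have := Nat.lt_pow_succ_log_self (b := 2) (by omega) n
      rw [Nat.succ_eq_add_one] at this
      omega
  · rintro k τ ⟨hfr, lo, hi, h17, h18, h19, hml, hlh, hhn, hk, hlo, hhi⟩ hne
    have hlt : lo + 1 < hi := by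
      by_contra h
      rw [h19, if_neg h] at hne
      exact hne rfl
    obtain ⟨k, rfl⟩ : ∃ k', k = k' + 1 := by
      refine Nat.exists_eq_succ_of_ne_zero ?_
      rintro rfl
      omega
    rw [pow_succ] at hk
    refine (RunsTo.seq (t := 9) (t' := 32 * (K + 1) + 13) ?_).mono (by omega) fun _ h => h
    refine (RunsTo.block ?_).mono (by simp) fun _ h => h
    have hE' : Env n K a b c d m τ := hE.of_eq fun r hr => hfr r (by omega)
    simp only [wp, State.set_reg, BinOp.eval, Nat.reduceEqDiff, reduceIte, h17, h18, hE'.h7]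
    have hmid1 : lo < (lo + hi) / 2 := by omega
    have hmid2 : (lo + hi) / 2 < hi := by omega
    have hmid3 : (lo + hi) / 2 - lo ≤ 2 ^ k := by omega
    have hmid4 : hi - (lo + hi) / 2 ≤ 2 ^ k := by omega
    generalize (lo + hi) / 2 = mid at hmid1 hmid2 hmid3 hmid4 ⊢
    refine ⟨by omega, by omega, by omega, by omega, by omega, ?_⟩
    refine (RunsTo.seq (t := 32 * (K + 1)) (t' := 12) ?_).mono (by omega) fun _ h => h
    refine (runsTo_check (p := p) (t := t) (mid := mid) (s := mid - 2 * K) (by omega) ?_ ?_ ?_ ?_ ?_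
      (by omega)).mono (by omega) ?_
    · simp only [State.set_reg, Nat.reduceEqDiff, reduceIte, hfr 10 (by omega), h10]
    · simp only [State.set_reg, Nat.reduceEqDiff, reduceIte, hfr 11 (by omega), h11]
    · simp only [State.set_reg, Nat.reduceEqDiff, reduceIte]
    · simp only [State.set_reg, Nat.reduceEqDiff, reduceIte]
    · simp only [State.set_reg, Nat.reduceEqDiff, reduceIte]
    rintro ρ ⟨hρ, i, h23, hi1, hi2, hi3, hi4⟩
    have hρ' : ∀ r < 17, ρ.reg r = σ.reg r := by
      intro r hr
      rw [hρ r (by omega), ← hfr r hr]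
      simp (disch := omega) only [State.set_reg_ne]
    have hρ6 : ρ.reg 6 = 1 := by rw [hρ' 6 (by omega), hE.h6]
    have h17' : ρ.reg 17 = lo := by
      rw [hρ 17 (by omega)]
      simp (disch := omega) only [State.set_reg_ne, h17]
    have h18' : ρ.reg 18 = hi := by
      rw [hρ 18 (by omega)]
      simp (disch := omega) only [State.set_reg_ne, h18]
    have h21' : ρ.reg 21 = mid := by
      rw [hρ 21 (by omega)]
      simp only [State.set_reg, Nat.reduceEqDiff, reduceIte]
    refine (RunsTo.seq (t := 1) (t' := 10) ?_).mono (by omega) fun _ h => h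
    refine (RunsTo.block ?_).mono (by simp) fun _ h => h
    simp only [wp, BinOp.eval, h23, h21']
    refine ⟨by split_ifs <;> omega, ?_⟩
    refine (RunsTo.seq (t := 2) (t' := 3) ?_).mono (by omega) fun _ h => h
    refine RunsTo.branch (t := 1) (fun hc => ?_) (fun hc => ?_)
    · simp only [State.set_reg, reduceIte] at hc
      have him : i < mid := by
        by_contra h
        rw [if_neg h] at hc
        exact hc rfl
      refine (RunsTo.block ?_).mono (by simp) fun _ h => h
      simp only [wp, State.set_reg, BinOp.eval, Nat.reduceEqDiff, reduceIte, h21', hρ6, mul_one]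
      refine ⟨by omega, ?_⟩
      refine (RunsTo.block ?_).mono (by simp) fun _ h => h
      simp only [wp, State.set_reg, BinOp.eval, Nat.reduceEqDiff, reduceIte, h17', hρ6]
      refine ⟨by omega, by split_ifs <;> omega, k, by omega, fun r hr => ?_, lo, mid, ?_⟩
      · simp (disch := omega) only [State.set_reg_ne]
        exact hρ' r hr
      · simp only [State.set_reg, Nat.reduceEqDiff, reduceIte, h17']
        exact ⟨trivial, trivial, trivial, hml, by omega, by omega, hmid3, hlo, i, by omega, him,
          hi4 him⟩
    · simp only [State.set_reg, reduceIte] at hc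
      have him : i = mid := by
        by_contra h
        rw [if_pos (by omega)] at hc
        omega
      refine (RunsTo.block ?_).mono (by simp) fun _ h => h
      simp only [wp, State.set_reg, BinOp.eval, Nat.reduceEqDiff, reduceIte, h21', hρ6, mul_one]
      refine ⟨by omega, ?_⟩
      refine (RunsTo.block ?_).mono (by simp) fun _ h => h
      simp only [wp, State.set_reg, BinOp.eval, Nat.reduceEqDiff, reduceIte, h18', hρ6]
      refine ⟨by omega, by split_ifs <;> omega, k, by omega, fun r hr => ?_, mid, hi, ?_⟩
      · simp (disch := omega) only [State.set_reg_ne]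
        exact hρ' r hr
      · simp only [State.set_reg, Nat.reduceEqDiff, reduceIte, h18']
        exact ⟨trivial, trivial, trivial, by omega, by omega, by omega, hmid4,
          fun j hj1 hj2 => hi3 j (by omega) (by omega), hhi⟩
  · rintro τ ⟨h0, k, hfr, lo, hi, h17, h18, h19, hml, hlh, hhn, hk, hlo, i, hi1, hi2, hi3⟩
    have hlt : ¬ lo + 1 < hi := by
      intro h
      rw [h19, if_pos h] at h0
      omega
    refine ⟨hfr, lo, h17, hml, by omega, hlo, fun h => hi3 ?_⟩
    -- With `hi = lo + 1` the two blocks overlap in all but `lo`, so the break in the upper one is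
    -- `lo` itself.
    rcases Nat.lt_or_ge i lo with h' | h'
    · exact hlo i (by omega) h'
    · rwa [show i = lo by omega]

theorem runsTo_scan {p t l : ℕ} (hw : 2 * (2 * K + l) + 4 < 2 ^ w) (hE : Env n K a b c d m σ)
    (h10 : σ.reg 10 = t) (h11 : σ.reg 11 = p) (h17 : σ.reg 17 = l) (ht : t ≤ 2 * K) :
    RunsTo w X Y scanProgram σ (40 * (K + 2)) fun σ' =>
      (∀ r < 17, r ≠ 10 → σ'.reg r = σ.reg r) ∧ ∃ u, σ'.reg 10 = u ∧ t ≤ u ∧ u ≤ 2 * K ∧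
        (∀ v, t ≤ v → v < u → charAt X Y .Y (v + l) = charAt X Y .X ((v - t + l) % p)) ∧
        (u = 2 * K ∨ charAt X Y .Y (u + l) ≠ charAt X Y .X ((u - t + l) % p)) := by
  set x := charAt X Y .X with hx
  set y := charAt X Y .Y with hy
  let Inv : ℕ → State → Prop := fun k τ => (∀ r < 18, τ.reg r = σ.reg r) ∧ ∃ u g,
    τ.reg 20 = u ∧ τ.reg 24 = g ∧ t ≤ u ∧ u ≤ 2 * K ∧ k = 2 * K - u + g ∧
    (∀ v, t ≤ v → v < u → y (v + l) = x ((v - t + l) % p)) ∧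
    (g = 0 → u = 2 * K ∨ y (u + l) ≠ x ((u - t + l) % p))
  have hE' : ∀ τ : State, (∀ r < 18, τ.reg r = σ.reg r) → τ.reg 10 = t ∧ τ.reg 11 = p ∧
      τ.reg 17 = l ∧ τ.reg 6 = 1 ∧ τ.reg 7 = 2 * K := fun τ h =>
    ⟨by rw [h _ (by omega), h10], by rw [h _ (by omega), h11], by rw [h _ (by omega), h17],
      by rw [h _ (by omega), hE.h6], by rw [h _ (by omega), hE.h7]⟩
  refine (RunsTo.seq (t := 3) (t' := (2 * K + 2) * 16 + 2) ?_).mono (by omega) fun _ h => h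
  refine (RunsTo.block (Post := Inv (2 * K - t + 1)) ?_).mono (by simp) fun ρ hρ =>
    (RunsTo.seq (t := (2 * K - t + 2) * 16) (t' := 1)
      ((RunsTo.loop Inv (t := 15) ?_ _ _ hρ).mono le_rfl ?_)).mono (by omega) fun _ h => h
  · simp only [wp, BinOp.eval, h10, hE.h6, mul_one]
    refine ⟨by omega, by omega, fun r hr => ?_, t, 1, ?_⟩
    · simp (disch := omega) only [State.set_reg_ne]
    · simp only [State.set_reg, Nat.reduceEqDiff, reduceIte]
      exact ⟨trivial, trivial, le_rfl, ht, trivial, fun v h1 h2 => by omega,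
        fun h => h.elim⟩
  · rintro k τ ⟨hfr, u, g, h20, h24, htu, huK, hk, hgood, hbad⟩ hne
    obtain ⟨e10, e11, e17, e6, e7⟩ := hE' τ hfr
    have hg : g ≠ 0 := by rwa [h24] at hne
    have hmod : (u - t + l) % p ≤ u - t + l := Nat.mod_le _ _
    have hframe : ∀ (τ' : State), (∀ r < 18, τ'.reg r = τ.reg r) →
        ∀ r < 18, τ'.reg r = σ.reg r := fun τ' h r hr => (h r hr).trans (hfr r hr)
    refine (RunsTo.block ?_).mono (by simp) fun _ h => h
    simp only [wp, State.set_reg, BinOp.eval,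
      Nat.reduceEqDiff, reduceIte, h20, h24, e10, e11, e17, e7, ← hx, ← hy]
    by_cases h1 : u < 2 * K ∧ y (u + l) = x ((u - t + l) % p)
    · simp only [if_pos h1.1, if_pos h1.2]
      refine ⟨by omega, by omega, by omega, by omega, by omega, by omega, by omega, by omega,
        k - g, by omega, hframe _ fun r hr => ?_, u + 1, 1, ?_⟩
      · simp (disch := omega) only [State.set_reg_ne]
      · simp only [State.set_reg, Nat.reduceEqDiff, reduceIte]
        refine ⟨trivial, trivial, by omega, by omega, by omega, fun v hv1 hv2 => ?_,
          fun h => h.elim⟩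
        rcases Nat.lt_succ_iff_lt_or_eq.1 hv2 with hv | rfl
        · exact hgood v hv1 hv
        · exact h1.2
    · have h3 : ((if u < 2 * K then 1 else 0) *
          if y (u + l) = x ((u - t + l) % p) then 1 else 0) = 0 := by
        by_cases h4 : u < 2 * K
        · rw [if_neg fun h5 => h1 ⟨h4, h5⟩, mul_zero]
        · rw [if_neg h4, zero_mul]
      simp only [h3]
      refine ⟨by split_ifs <;> omega, by omega, by omega, by omega, by omega,
        by omega, by omega, by omega, k - g, by omega,
        hframe _ fun r hr => ?_, u, 0, ?_⟩
      · simp (disch := omega) only [State.set_reg_ne]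
      · simp only [State.set_reg, Nat.reduceEqDiff, reduceIte]
        refine ⟨by omega, trivial, by omega, by omega, by omega, hgood, fun _ => ?_⟩
        by_cases h4 : u < 2 * K
        · exact Or.inr fun h5 => h1 ⟨h4, h5⟩
        · exact Or.inl (by omega)
  · rintro τ ⟨h0, k, hfr, u, g, h20, h24, htu, huK, hk, hgood, hbad⟩
    obtain ⟨e10, e11, e17, e6, e7⟩ := hE' τ hfr
    refine (RunsTo.block ?_).mono (by simp) fun _ h => h
    simp only [wp, State.set_reg, BinOp.eval, reduceIte, h20, e6, mul_one]
    refine ⟨by omega, fun r hr hr' => ?_, u, ?_⟩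
    · rw [if_neg hr']
      exact hfr r (by omega)
    · exact ⟨rfl, htu, huK, hgood, hbad (h24.symm.trans h0)⟩

/-! ### Sample size and random testing of a shift -/

/-- Computes the number of samples of one test in register `9`. Register `12` records whether the
error parameter is below `2 / 3`. -/
def rateProgram : Program :=
  .seq (block (.const 13 2) [.arith .mul 13 13 5, .const 14 3, .arith .mul 14 14 4,
      .arith .lt 12 14 13])
    (.seq (.branch 12
      (.seq (block (.const 15 0) [.arith .mul 16 4 6, .const 18 1])
        (.seq (.loop 18 (block (.arith .lt 18 16 5) [.arith .add 15 15 18, .arith .mul 19 16 18,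
          .arith .add 16 16 19]))
        (block (.arith .mul 17 6 6) [])))
      (block (.arith .sub 15 5 4) [.arith .mul 17 4 6]))
    (block (.const 14 3) [.arith .mul 14 14 2, .arith .mul 14 14 0, .arith .mul 14 14 15,
      .arith .mul 16 3 17, .arith .div 14 14 16, .arith .add 9 14 6]))

/-- Tests the shift in register `10` at random positions, until a mismatch is found. Register `16`
records whether there was none. -/
def sampleProgram : Program :=
  .seq (block (.arith .mul 13 9 6) [])
    (.loop 13 (.seq (.instr (.rand 14 0)) (block (.arith .add 15 10 14) [.cmp 16 .X 14 .Y 15,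
      .arith .sub 13 13 6, .arith .mul 13 13 16])))

variable {n K a b c d m : ℕ} {σ : State}
  {α : Type*} [DecidableEq α] {N N' w : ℕ} {X : Fin N → α} {Y : Fin N' → α}

/-- The number of samples of one test, where `k` is the least number with `d ≤ c * 2 ^ k`. -/
def sampleCount (n a b c d k : ℕ) : ℕ :=
  3 * a * n * (if 3 * c < 2 * d then k else d - c) / (b * if 3 * c < 2 * d then 1 else c) + 1

theorem runsTo_double {k : ℕ} (hw : 2 * d + 2 * c + k + 4 < 2 ^ w) (hE : Env n K a b c d m σ)
    (hk : d ≤ c * 2 ^ k) (hmin : ∀ j < k, c * 2 ^ j < d) (h15 : σ.reg 15 = 0)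
    (h16 : σ.reg 16 = c) (h18 : σ.reg 18 = 1) :
    RunsTo w X Y (.loop 18 (block (.arith .lt 18 16 5) [.arith .add 15 15 18,
      .arith .mul 19 16 18, .arith .add 16 16 19])) σ ((k + 2) * 8) fun σ' =>
      (∀ r < 13, σ'.reg r = σ.reg r) ∧ σ'.reg 15 = k := by
  let Inv : ℕ → State → Prop := fun f τ => (∀ r < 13, τ.reg r = σ.reg r) ∧ ∃ i g,
    τ.reg 15 = i ∧ τ.reg 16 = c * 2 ^ i ∧ τ.reg 18 = g ∧ i ≤ k ∧ f = k - i + g ∧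
    (g = 0 → i = k)
  -- No overflow: the previous power is below `d` by minimality of `k`, and one doubling follows.
  have hle : ∀ i ≤ k, c * 2 ^ i ≤ 2 * d + c := by
    rintro (_ | i) hi
    · omega
    · have := hmin i hi
      rw [pow_succ, ← mul_assoc]
      omega
  refine (RunsTo.loop Inv (t := 7) ?_ (k + 1) σ ?_).mono (by omega) ?_
  · rintro f τ ⟨hfr, i, g, e15, e16, e18, hik, hf, hg⟩ hne
    have e5 : τ.reg 5 = d := by rw [hfr 5 (by omega), hE.h5]
    have hg0 : g ≠ 0 := by rwa [e18] at hne
    have hlei := hle i hik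
    refine (RunsTo.block ?_).mono (by simp) fun _ h => h
    simp only [wp, State.set_reg, BinOp.eval, Nat.reduceEqDiff, reduceIte, e15, e16, e18, e5]
    have hframe : ∀ (τ' : State), (∀ r < 13, τ'.reg r = τ.reg r) →
        ∀ r < 13, τ'.reg r = σ.reg r := fun τ' h r hr => (h r hr).trans (hfr r hr)
    by_cases h : c * 2 ^ i < d
    · have hik' : i < k := by
        by_contra h'
        rw [show i = k by omega] at h
        omega
      simp only [if_pos h, mul_one]
      refine ⟨by omega, by omega, by omega, by omega, f - g, by omega, hframe _ fun r hr => ?_,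
        i + 1, 1, ?_⟩
      · simp (disch := omega) only [State.set_reg_ne]
      · simp only [State.set_reg, Nat.reduceEqDiff, reduceIte]
        exact ⟨trivial, by rw [pow_succ]; ring, trivial, by omega, by omega, fun h => h.elim⟩
    · have hik' : i = k := by
        by_contra h'
        exact h (hmin i (by omega))
      simp only [if_neg h, mul_zero, add_zero]
      refine ⟨by omega, by omega, by omega, by omega, f - g, by omega, hframe _ fun r hr => ?_,
        i, 0, ?_⟩
      · simp (disch := omega) only [State.set_reg_ne]
      · simp only [State.set_reg, Nat.reduceEqDiff, reduceIte]
        exact ⟨trivial, trivial, trivial, by omega, by omega, fun _ => hik'⟩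
  · exact ⟨fun _ _ => rfl, 0, 1, h15, by rw [h16]; ring, h18, by omega, by omega, by omega⟩
  · rintro τ ⟨h0, f, hfr, i, g, e15, e16, e18, hik, hf, hg⟩
    exact ⟨hfr, by rw [e15, hg (e18.symm.trans h0)]⟩

theorem runsTo_rate {k B : ℕ} (hB : 4 ≤ B) (hBw : B ^ 6 ≤ 2 ^ w) (han : a + n ≤ B)
    (hbcd : b + c + d ≤ B) (hE : Env n K a b c d m σ)
    (hk : d ≤ c * 2 ^ k) (hkd : k ≤ d) (hmin : ∀ j < k, c * 2 ^ j < d) :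
    RunsTo w X Y rateProgram σ ((if 3 * c < 2 * d then k * 8 else 0) + 100) fun σ' =>
      (∀ r < 12, r ≠ 9 → σ'.reg r = σ.reg r) ∧ σ'.reg 9 = sampleCount n a b c d k ∧
      sampleCount n a b c d k < 2 ^ w ∧ σ'.reg 12 = if 3 * c < 2 * d then 1 else 0 := by
  have hlin : 16 * (4 * B) ≤ B ^ 6 := by
    calc 16 * (4 * B) ≤ B ^ 2 * (B * B) := Nat.mul_le_mul (by nlinarith) (by nlinarith)
      _ = B ^ 4 := by ring
      _ ≤ B ^ 6 := Nat.pow_le_pow_right (by omega) (by omega)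
  have h3 : 3 * a ≤ B ^ 2 := by nlinarith
  have h4 : 3 * a * n ≤ B ^ 3 := by
    rw [pow_succ]
    exact Nat.mul_le_mul h3 (by omega)
  have h5 : ∀ num ≤ B, 3 * a * n * num ≤ B ^ 4 := fun num hn => by
    rw [pow_succ]
    exact Nat.mul_le_mul h4 hn
  have h6 : ∀ den ≤ B, b * den ≤ B ^ 2 := fun den hd => by
    rw [sq]
    exact Nat.mul_le_mul (by omega) hd
  -- The largest intermediate value is `3 * a * n * num`, at most `B ^ 4`.
  have hpow : ∀ e ≤ 4, B ^ e + 1 < 2 ^ w := by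
    intro e he
    have h1 : B ^ e ≤ B ^ 4 := Nat.pow_le_pow_right (by omega) he
    have h2 : 4 ^ 4 ≤ B ^ 4 := Nat.pow_le_pow_left hB 4
    have h3 : B ^ 4 * 16 ≤ B ^ 6 := by
      rw [pow_add B 4 2]
      exact Nat.mul_le_mul_left _ (by nlinarith)
    omega
  have hp2 := hpow 2 (by omega)
  have hp3 := hpow 3 (by omega)
  have hp4 := hpow 4 (by omega)
  have hfinal : ∀ (τ : State) (num den : ℕ), (∀ r < 12, r ≠ 9 → τ.reg r = σ.reg r) →
      τ.reg 12 = (if 3 * c < 2 * d then 1 else 0) → τ.reg 15 = num → τ.reg 17 = den →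
      num = (if 3 * c < 2 * d then k else d - c) → den = (if 3 * c < 2 * d then 1 else c) →
      RunsTo w X Y (block (.const 14 3) [.arith .mul 14 14 2, .arith .mul 14 14 0,
        .arith .mul 14 14 15, .arith .mul 16 3 17, .arith .div 14 14 16, .arith .add 9 14 6]) τ 13
      fun σ' => (∀ r < 12, r ≠ 9 → σ'.reg r = σ.reg r) ∧ σ'.reg 9 = sampleCount n a b c d k ∧
        sampleCount n a b c d k < 2 ^ w ∧ σ'.reg 12 = if 3 * c < 2 * d then 1 else 0 := by
    intro τ num den hfr e12 e15 e17 hnum hden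
    have h5' := h5 num (by split_ifs at hnum <;> omega)
    have h6' := h6 den (by split_ifs at hden <;> omega)
    have h7 : 3 * a * n * num / (b * den) ≤ 3 * a * n * num := Nat.div_le_self _ _
    refine (RunsTo.block ?_).mono (by simp) fun _ h => h
    simp only [wp, State.set_reg, BinOp.eval,
      Nat.reduceEqDiff, reduceIte, e15, e17, e12,
      hfr 0 (by omega) (by omega), hfr 2 (by omega) (by omega), hfr 3 (by omega) (by omega),
      hfr 6 (by omega) (by omega), hE.h0, hE.h2, hE.h3, hE.h6]
    refine ⟨by omega, by omega, by omega, by omega, by omega, by omega, by omega,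
      fun r hr hr9 => ?_, ?_, ?_, trivial⟩
    · simp (disch := omega) only [if_neg]
      exact hfr r hr hr9
    · rw [sampleCount, ← hnum, ← hden]
    · rw [sampleCount, ← hnum, ← hden]
      omega
  refine (RunsTo.seq (t := 9) (t' := (if 3 * c < 2 * d then k * 8 else 0) + 80) ?_).mono
    (by omega) fun _ h => h
  refine (RunsTo.block ?_).mono (by simp) fun _ h => h
  simp only [wp, State.set_reg, BinOp.eval, Nat.reduceEqDiff, reduceIte, hE.h4, hE.h5]
  refine ⟨by omega, by omega, by omega, by omega, by split_ifs <;> omega, ?_⟩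
  refine (RunsTo.seq (t := (if 3 * c < 2 * d then k * 8 else 0) + 50) (t' := 13) ?_).mono
    (by omega) fun _ h => h
  refine RunsTo.branch (t := (if 3 * c < 2 * d then k * 8 else 0) + 49) (fun hc => ?_)
    (fun hc => ?_)
  · simp only [State.set_reg, Nat.reduceEqDiff, reduceIte] at hc
    have hcd : 3 * c < 2 * d := by
      by_contra h
      rw [if_neg h] at hc
      exact hc rfl
    rw [show (if 3 * c < 2 * d then k * 8 else 0) = k * 8 from if_pos hcd]
    refine (RunsTo.seq (t := 5) (t' := k * 8 + 40) ?_).mono (by omega) fun _ h => h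
    refine (RunsTo.block ?_).mono (by simp) fun _ h => h
    simp only [wp, State.set_reg, BinOp.eval,
      Nat.reduceEqDiff, reduceIte, hE.h4, hE.h6, mul_one, if_pos hcd]
    refine ⟨by omega, by omega, by omega, ?_⟩
    refine (RunsTo.seq (t := (k + 2) * 8) (t' := 1) ?_).mono (by omega) fun _ h => h
    refine (runsTo_double (n := n) (K := K) (a := a) (b := b) (m := m) (by omega) ?_ hk hmin
      ?_ ?_ ?_).mono le_rfl ?_
    · repeat' first | exact hE | refine Env.set ?_ (by omega)
    · simp only [State.set_reg, Nat.reduceEqDiff, reduceIte]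
    · simp only [State.set_reg, Nat.reduceEqDiff, reduceIte]
    · simp only [State.set_reg, Nat.reduceEqDiff, reduceIte]
    rintro ρ ⟨hρ, e15⟩
    have hρ' : ∀ r < 12, r ≠ 9 → ρ.reg r = σ.reg r := by
      intro r hr _
      rw [hρ r (by omega)]
      simp (disch := omega) only [State.set_reg_ne]
    have e12 : ρ.reg 12 = 1 := by
      rw [hρ 12 (by omega)]
      simp only [State.set_reg, Nat.reduceEqDiff, reduceIte]
    refine (RunsTo.block ?_).mono (by simp) fun _ h => h
    simp only [wp, BinOp.eval, hρ' 6 (by omega) (by omega), hE.h6, mul_one]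
    refine ⟨by omega, (hfinal _ k 1 ?_ ?_ ?_ ?_ ?_ ?_).mono le_rfl ?_⟩
    · intro r hr hr'
      rw [State.set_reg_ne _ _ _ _ (by omega), hρ' r hr hr']
    · simp only [State.set_reg, Nat.reduceEqDiff, reduceIte, e12, if_pos hcd]
    · simp only [State.set_reg, Nat.reduceEqDiff, reduceIte, e15]
    · simp only [State.set_reg, reduceIte]
    · rw [if_pos hcd]
    · rw [if_pos hcd]
    · rw [if_pos hcd]
      exact fun _ h => h
  · simp only [State.set_reg, Nat.reduceEqDiff, reduceIte] at hc
    have hcd : ¬ 3 * c < 2 * d := by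
      intro h
      rw [if_pos h] at hc
      exact one_ne_zero hc
    refine (RunsTo.block ?_).mono (by simp) fun _ h => h
    simp only [wp, State.set_reg, BinOp.eval,
      Nat.reduceEqDiff, reduceIte, hE.h4, hE.h5, hE.h6, mul_one]
    refine ⟨by omega, by omega, hfinal _ (d - c) c ?_ ?_ ?_ ?_ ?_ ?_⟩
    · intro r hr hr'
      simp (disch := omega) only [State.set_reg_ne]
    · simp only [State.set_reg, Nat.reduceEqDiff, reduceIte]
    · simp only [State.set_reg, Nat.reduceEqDiff, reduceIte]
    · simp only [State.set_reg, Nat.reduceEqDiff, reduceIte]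
    · rw [if_neg hcd]
    · rw [if_neg hcd]

/-- The number of positions `i < n` where `X` and the part of `Y` from `t` on differ. -/
def mismatches (X : Fin N → α) (Y : Fin N' → α) (n t : ℕ) : Finset ℕ :=
  (Finset.range n).filter fun i => charAt X Y .X i ≠ charAt X Y .Y (t + i)

/-- The test of the shift `t` with `q` samples passes with probability `(1 - h / n) ^ q`, where
`h` is the number of mismatches. -/
theorem good_sampleLoop {S : Set State} {T n t : ℕ} {rest : List Program} {v₀ v₁ : ℝ}
    (hv₀ : 0 ≤ v₀) (hv₁ : 0 ≤ v₁) (hn : 0 < n) (hw : t + n + 2 < 2 ^ w) {σ₀ : State}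
    (h0 : σ₀.reg 0 = n) (h6 : σ₀.reg 6 = 1) (h10 : σ₀.reg 10 = t)
    (hpass : ∀ σ, (∀ r < 13, σ.reg r = σ₀.reg r) → σ.reg 16 = 1 → Good w X Y S T v₀ (rest, σ))
    (hfail : ∀ σ i, (∀ r < 13, σ.reg r = σ₀.reg r) → σ.reg 16 = 0 → σ.reg 14 = i → i < n →
      charAt X Y .X i ≠ charAt X Y .Y (t + i) → Good w X Y S T v₁ (rest, σ)) :
    ∀ (q : ℕ) (σ : State), (∀ r < 13, σ.reg r = σ₀.reg r) → σ.reg 13 = q + 1 → q + 1 < 2 ^ w →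
      Good w X Y S (T + (q + 1) * 10 + 1)
        ((1 - (mismatches X Y n t).card / n) ^ (q + 1) * v₀ +
          (1 - (1 - (mismatches X Y n t).card / n) ^ (q + 1)) * v₁)
        (.loop 13 (.seq (.instr (.rand 14 0)) (block (.arith .add 15 10 14) [.cmp 16 .X 14 .Y 15,
          .arith .sub 13 13 6, .arith .mul 13 13 16])) :: rest, σ) := by
  set x := charAt X Y .X with hx
  set y := charAt X Y .Y with hy
  set z : ℝ := 1 - (mismatches X Y n t).card / n with hz
  have hcard : (mismatches X Y n t).card ≤ n :=
    (Finset.card_filter_le _ _).trans_eq (Finset.card_range n)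
  have hn' : (0 : ℝ) < n := by exact_mod_cast hn
  have hz0 : 0 ≤ z := by
    rw [hz, sub_nonneg, div_le_one hn']
    exact_mod_cast hcard
  have hz1 : z ≤ 1 := by
    rw [hz]
    have : (0 : ℝ) ≤ (mismatches X Y n t).card / n := by positivity
    linarith
  -- These are the guarantees with `j` samples left. They satisfy `V (j + 1) = z * V j + (1 - z) *
  -- v₁`, which the induction on `q` unrolls.
  have hV : ∀ j, 0 ≤ z ^ j * v₀ + (1 - z ^ j) * v₁ := fun j => by
    have := pow_le_one₀ hz0 hz1 (n := j)
    have := pow_nonneg hz0 j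
    have h1 : 0 ≤ 1 - z ^ j := by linarith
    positivity
  -- one round of the loop, from the continuation after it
  have hround : ∀ (V : ℝ) (T' q : ℕ) (σ : State) (rest' : List Program), 0 ≤ V →
      (∀ r < 13, σ.reg r = σ₀.reg r) → σ.reg 13 = q + 1 → q + 1 < 2 ^ w →
      (∀ σ, (∀ r < 13, σ.reg r = σ₀.reg r) → σ.reg 13 = q → σ.reg 16 = 1 →
        Good w X Y S T' V (rest', σ)) →
      (∀ σ i, (∀ r < 13, σ.reg r = σ₀.reg r) → σ.reg 13 = 0 → σ.reg 16 = 0 → σ.reg 14 = i →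
        i < n → x i ≠ y (t + i) → Good w X Y S T' v₁ (rest', σ)) →
      Good w X Y S (T' + 9) (z * V + (1 - z) * v₁)
        ((.seq (.instr (.rand 14 0)) (block (.arith .add 15 10 14) [.cmp 16 .X 14 .Y 15,
          .arith .sub 13 13 6, .arith .mul 13 13 16])) :: rest', σ) := by
    intro V T' q σ rest' hV hσ h13 hq hpass hfail
    have e0 : σ.reg 0 = n := by rw [hσ 0 (by omega), h0]
    have e10 : σ.reg 10 = t := by rw [hσ 10 (by omega), h10]
    have e6 : σ.reg 6 = 1 := by rw [hσ 6 (by omega), h6]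
    have hgood := Good.rand (w := w) (X := X) (Y := Y) (S := S) (T := T' + 7) (σ := σ)
      (rest := block (.arith .add 15 10 14) [.cmp 16 .X 14 .Y 15,
          .arith .sub 13 13 6, .arith .mul 13 13 16] :: rest') (dst := 14) (bound := 0)
      (q := fun i => if x i = y (t + i) then V else v₁) (by omega) (by omega)
      (fun i _ => by split_ifs <;> assumption) ?_
    · refine Good.of_step (c' := (_ :: _ :: rest', σ)) rfl (hgood.mono (by omega) (le_of_eq ?_))
      rw [e0, Finset.sum_ite, Finset.sum_const, Finset.sum_const, nsmul_eq_mul, nsmul_eq_mul]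
      have h1 := Finset.card_filter_add_card_filter_not (s := Finset.range n)
        (fun i => x i = y (t + i))
      rw [Finset.card_range] at h1
      have h2 : (((Finset.range n).filter fun i => x i = y (t + i)).card : ℝ) +
          ((Finset.range n).filter fun i => ¬ x i = y (t + i)).card = n := by exact_mod_cast h1
      have h3 : z * n = ((Finset.range n).filter fun i => x i = y (t + i)).card := by
        rw [hz, sub_mul, div_mul_cancel₀ _ hn'.ne', mismatches]
        linarith
      rw [eq_div_iff hn'.ne', ← h3]
      have h4 : (((Finset.range n).filter fun i => ¬ x i = y (t + i)).card : ℝ) = (1 - z) * n := by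
        linarith
      rw [h4]
      ring
    · intro i hi
      rw [e0] at hi
      by_cases h : x i = y (t + i)
      · simp only [if_pos h]
        refine RunsTo.block (Post := fun σ => (∀ r < 13, σ.reg r = σ₀.reg r) ∧ σ.reg 13 = q ∧
          σ.reg 16 = 1) ?_ S T' V rest' fun σ hσ => hpass σ hσ.1 hσ.2.1 hσ.2.2
        simp only [wp, State.set_reg, BinOp.eval,
          Nat.reduceEqDiff, reduceIte, e10, e6, h13, ← hx, ← hy, if_pos h]
        refine ⟨by omega, by omega, by omega, by omega, fun r hr => ?_, by omega, trivial⟩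
        simp (disch := omega) only [if_neg]
        exact hσ r hr
      -- On a mismatch the counter is multiplied by zero, which ends the loop and leaves the
      -- mismatching position in register `14`.
      · simp only [if_neg h]
        refine RunsTo.block (Post := fun σ => (∀ r < 13, σ.reg r = σ₀.reg r) ∧ σ.reg 13 = 0 ∧
          σ.reg 16 = 0 ∧ σ.reg 14 = i) ?_ S T' v₁ rest'
          fun σ hσ => hfail σ i hσ.1 hσ.2.1 hσ.2.2.1 hσ.2.2.2 hi h
        simp only [wp, State.set_reg, BinOp.eval,
          Nat.reduceEqDiff, reduceIte, e10, e6, h13, ← hx, ← hy, if_neg h]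
        refine ⟨by omega, by omega, by omega, by omega, fun r hr => ?_, by omega, trivial, trivial⟩
        simp (disch := omega) only [if_neg]
        exact hσ r hr
  have hexit : ∀ (σ : State) (v : ℝ) (T' : ℕ), T + 1 ≤ T' → σ.reg 13 = 0 →
      Good w X Y S T v (rest, σ) → ∀ p, Good w X Y S T' v (.loop 13 p :: rest, σ) := by
    intro σ v T' hT h13 hg p
    refine (Good.of_step (c' := (rest, σ)) ?_ hg).mono hT le_rfl
    simp [step, h13]
  intro q
  induction q with
  | zero =>
    intro σ hσ h13 hq
    refine (Good.of_step (c' := (_ :: _ :: rest, σ)) (by simp [step, h13]; rfl)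
      (hround v₀ (T + 1) 0 σ _ hv₀ hσ h13 hq
        (fun σ h1 h2 h3 => hexit σ _ _ le_rfl h2 (hpass σ h1 h3) _)
        (fun σ i h1 h2 h3 h4 h5 h6 => hexit σ _ _ le_rfl h2 (hfail σ i h1 h3 h4 h5 h6) _))).mono
      (by omega) (by simp)
  | succ q ih =>
    intro σ hσ h13 hq
    refine (Good.of_step (c' := (_ :: _ :: rest, σ)) (by simp [step, h13])
      (hround _ (T + (q + 1) * 10 + 1) (q + 1) σ _ (hV (q + 1)) hσ h13 hq
        (fun σ h1 h2 h3 => ih σ h1 h2 (by omega))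
        (fun σ i h1 h2 h3 h4 h5 h6 =>
          hexit σ _ _ (by omega) h2 (hfail σ i h1 h3 h4 h5 h6) _))).mono
      (by omega) (le_of_eq (by ring))

theorem good_sample {S : Set State} {T n t q : ℕ} {rest : List Program} {v₀ v₁ : ℝ}
    (hv₀ : 0 ≤ v₀) (hv₁ : 0 ≤ v₁) (hn : 0 < n) (hw : t + n + 2 < 2 ^ w) (hq : q + 1 < 2 ^ w)
    (h0 : σ.reg 0 = n) (h6 : σ.reg 6 = 1) (h9 : σ.reg 9 = q + 1) (h10 : σ.reg 10 = t)
    (hpass : ∀ σ', (∀ r < 13, σ'.reg r = σ.reg r) → σ'.reg 16 = 1 → Good w X Y S T v₀ (rest, σ'))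
    (hfail : ∀ σ' i, (∀ r < 13, σ'.reg r = σ.reg r) → σ'.reg 16 = 0 → σ'.reg 14 = i → i < n →
      charAt X Y .X i ≠ charAt X Y .Y (t + i) → Good w X Y S T v₁ (rest, σ')) :
    Good w X Y S (T + (q + 1) * 10 + 3)
      ((1 - (mismatches X Y n t).card / n) ^ (q + 1) * v₀ +
        (1 - (1 - (mismatches X Y n t).card / n) ^ (q + 1)) * v₁)
      (sampleProgram :: rest, σ) := by
  refine Good.of_step (c' := (_ :: _ :: rest, σ)) rfl ?_
  refine RunsTo.block (Post := fun σ' => (∀ r < 13, σ'.reg r = σ.reg r) ∧ σ'.reg 13 = q + 1) ?_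
    S _ _ _ fun σ' hσ' => good_sampleLoop hv₀ hv₁ hn hw h0 h6 h10 hpass hfail q σ' hσ'.1 hσ'.2 hq
  simp only [wp, State.set_reg, BinOp.eval, reduceIte, h9, h6, mul_one]
  refine ⟨hq, fun r hr => ?_, trivial⟩
  rw [if_neg (by omega)]

/-! ### From positions in `Y` to shifts and Hamming distances -/

section Bridge

variable {α : Type*} {n K : ℕ} {X : Fin n → α} {Y : Fin (n + 2 * K) → α}

theorem charAt_X {i : ℕ} (hi : i < n) : charAt X Y .X i = some (X ⟨i, hi⟩) := by
  rw [charAt, dif_pos hi]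

theorem charAt_window {t i : ℕ} (ht : t ≤ 2 * K) (hi : i < n)
    (hs : (t : ℤ) - K ∈ Set.Icc (-(K : ℤ)) (K : ℤ)) :
    charAt X Y .Y (t + i) = some (window Y ⟨(t : ℤ) - K, hs⟩ ⟨i, hi⟩) := by
  rw [charAt, dif_pos (by omega), window]
  congr 3
  simp only
  omega

theorem shift_mem {t : ℕ} (ht : t ≤ 2 * K) : (t : ℤ) - K ∈ Set.Icc (-(K : ℤ)) (K : ℤ) := by
  rw [Set.mem_Icc]
  omega

variable [DecidableEq α]

theorem card_mismatches {t : ℕ} (ht : t ≤ 2 * K) :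
    (mismatches X Y n t).card = hammingDist X (window Y ⟨(t : ℤ) - K, shift_mem ht⟩) := by
  have h : Finset.range n = (Finset.univ : Finset (Fin n)).map Fin.valEmbedding := by
    rw [Fin.map_valEmbedding_univ, Nat.Iio_eq_range]
  rw [hammingDist, mismatches, h, Finset.filter_map, Finset.card_map]
  congr 1
  ext i
  simp only [Finset.mem_filter, Finset.mem_univ, true_and, Function.comp, Fin.valEmbedding_apply]
  rw [charAt_X i.2, charAt_window ht i.2 (shift_mem ht), ne_eq, Option.some_inj]

theorem correct_close {t : ℕ} {r : ℝ} (ht : t ≤ 2 * K)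
    (h : ((mismatches X Y n t).card : ℝ) ≤ 1 / r) :
    (Answer.close ((t : ℤ) - K)).Correct X Y r := by
  refine ⟨shift_mem ht, ?_⟩
  rwa [← card_mismatches ht]

theorem correct_far {r : ℝ}
    (h : ∀ t ≤ 2 * K, ¬ OccursAt (charAt X Y .X) (charAt X Y .Y) t n) :
    Answer.far.Correct X Y r := by
  rintro ⟨⟨s, hs⟩, hX⟩
  have hs1 := hs.1
  have hs2 := hs.2
  have ht : (s + K).toNat ≤ 2 * K := by omega
  refine h (s + K).toNat ht fun i hi => ?_
  rw [charAt_X hi, charAt_window ht hi (shift_mem ht), hX]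
  congr 3
  omega

theorem mismatches_eq_empty {t : ℕ}
    (h : OccursAt (charAt X Y .X) (charAt X Y .Y) t n) : mismatches X Y n t = ∅ := by
  rw [mismatches, Finset.filter_eq_empty_iff]
  intro i hi
  rw [not_not, h i (Finset.mem_range.1 hi)]

end Bridge

/-! ### The complete program and its success probability -/

/-- Answer `Close` with the shift in register `10`. -/
def closeProgram : Program := block (.arith .mul 1 10 6) [.const 0 1]

/-- Answer `Far`. -/
def farProgram : Program := .instr (.const 0 0)

/-- Decides about the shift in register `10` by sampling, or by a fair coin. -/
def finalProgram : Program :=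
  .branch 12 (.seq sampleProgram (.branch 16 closeProgram farProgram))
    (.seq (block (.arith .mul 1 10 6) [.const 16 2]) (.instr (.rand 0 16)))

/-- Continues after a mismatch was found for the first shift. -/
def mismatchProgram : Program :=
  .seq (block (.arith .lt 13 7 11) [])
    (.branch 13 farProgram (.seq (.seq breakProgram scanProgram) finalProgram))

/-- Continues with a long string `X`, after the exact search for its prefix. -/
def longProgram : Program :=
  .seq (block (.load 11 8) []) (.seq rateProgram (.seq sampleProgram
    (.branch 16 closeProgram mismatchProgram)))

/-- The case of a nontrivial rate. -/
def mainProgram : Program :=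
  .seq (block (.arith .add 7 1 1) [.arith .add 13 7 7, .arith .sub 14 13 0, .arith .sub 8 13 14])
    (.seq periodsProgram (.seq searchProgram (.seq (block (.arith .lt 16 7 10) [])
      (.branch 16 farProgram (.seq (block (.arith .add 13 7 7) [.arith .lt 16 13 0])
        (.branch 16 longProgram closeProgram))))))

/-- The matching test. -/
def matchingProgram : Program :=
  .seq (block (.const 6 1) [.arith .mul 13 2 0, .arith .lt 14 3 13])
    (.branch 14 mainProgram (block (.const 0 1) [.const 1 0]))

section Correctness

variable {α : Type*} [DecidableEq α] {n K a b c d m w : ℕ} {X : Fin n → α}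
  {Y : Fin (n + 2 * K) → α} {σ : State} {r : ℝ}

/-- The final states with a correct answer. -/
def correctStates (X : Fin n → α) (Y : Fin (n + 2 * K) → α) (r : ℝ) : Set State :=
  {σ | (answer K σ).Correct X Y r}

theorem mem_correctStates_close {t : ℕ} (h0 : σ.reg 0 ≠ 0) (h1 : σ.reg 1 = t) (ht : t ≤ 2 * K)
    (h : ((mismatches X Y n t).card : ℝ) ≤ 1 / r) : σ ∈ correctStates X Y r := by
  change (answer K σ).Correct X Y r
  rw [answer, if_neg h0, h1]
  exact correct_close ht h

theorem mem_correctStates_far (h0 : σ.reg 0 = 0)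
    (h : ∀ t ≤ 2 * K, ¬ OccursAt (charAt X Y .X) (charAt X Y .Y) t n) :
    σ ∈ correctStates X Y r := by
  change (answer K σ).Correct X Y r
  rw [answer, if_pos h0]
  exact correct_far h

theorem good_close {t : ℕ} {v : ℝ} (hw : 2 * K + 1 < 2 ^ w) (h6 : σ.reg 6 = 1)
    (h10 : σ.reg 10 = t) (ht : t ≤ 2 * K) (hv : v ≤ 1)
    (h : 0 < v → ((mismatches X Y n t).card : ℝ) ≤ 1 / r) :
    Good w X Y (correctStates X Y r) 3 v ([closeProgram], σ) := by
  refine RunsTo.block (Post := fun σ => σ.reg 0 ≠ 0 ∧ σ.reg 1 = t) ?_ _ 0 v []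
    fun σ' hσ' => Good.halt 0 hv fun hv' => mem_correctStates_close hσ'.1 hσ'.2 ht (h hv')
  simp only [wp, State.set_reg, BinOp.eval, Nat.reduceEqDiff, reduceIte, h6, h10, mul_one]
  exact ⟨by omega, by omega, one_ne_zero, trivial⟩

theorem good_far {v : ℝ} (hv : v ≤ 1)
    (h : 0 < v → ∀ t ≤ 2 * K, ¬ OccursAt (charAt X Y .X) (charAt X Y .Y) t n) :
    Good w X Y (correctStates X Y r) 1 v ([farProgram], σ) := by
  refine RunsTo.instr (Post := fun σ => σ.reg 0 = 0) ?_ _ 0 v []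
    fun σ' hσ' => Good.halt 0 hv fun hv' => mem_correctStates_far hσ' (h hv')
  simp only [wp, State.set_reg, reduceIte]
  exact ⟨by positivity, trivial⟩

/-- A bad shift passes the test with probability at most `δ ^ 3`. -/
structure SampleBound (n q : ℕ) (r δ : ℝ) : Prop where
  pos : 0 < δ
  lt_one : δ < 1
  pow_le : ∀ h : ℕ, h ≤ n → 1 / r < h → (1 - (h : ℝ) / n) ^ (q + 1) ≤ δ ^ 3

/-- The probability of a correct answer after a mismatch for the first shift. -/
noncomputable def finalProb (c d : ℕ) (δ : ℝ) : ℝ := if 3 * c < 2 * d then 1 - δ ^ 3 else 1 / 2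

theorem finalProb_le_one {δ : ℝ} (hδ : 0 < δ) : finalProb c d δ ≤ 1 := by
  rw [finalProb]
  split_ifs
  · have := pow_pos hδ 3
    linarith
  · norm_num

theorem finalProb_nonneg {δ : ℝ} (hδ : 0 < δ) (hδ1 : δ < 1) : 0 ≤ finalProb c d δ := by
  rw [finalProb]
  split_ifs
  · have := pow_le_one₀ hδ.le hδ1.le (n := 3)
    linarith
  · norm_num

/-- As only `t` can match exactly, a sampled mismatch proves `Far`. The test therefore errs only by
passing a bad shift. For the coin, `Close` is right if `t` matches exactly, and `Far` is right
otherwise. -/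
theorem good_final {q t : ℕ} {δ : ℝ} (hn : 0 < n) (hw : 2 * K + n + 4 < 2 ^ w)
    (hq : q + 1 < 2 ^ w) (hs : SampleBound n q r δ) (h0 : σ.reg 0 = n) (h6 : σ.reg 6 = 1)
    (h9 : σ.reg 9 = q + 1) (h10 : σ.reg 10 = t)
    (h12 : σ.reg 12 = if 3 * c < 2 * d then 1 else 0) (hr : 0 < r) (ht : t ≤ 2 * K)
    (huniq : ∀ s ≤ 2 * K, OccursAt (charAt X Y .X) (charAt X Y .Y) s n → s = t) :
    Good w X Y (correctStates X Y r) ((q + 1) * 10 + 20) (finalProb c d δ)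
      ([finalProgram], σ) := by
  set z : ℝ := 1 - (mismatches X Y n t).card / n with hz
  have hcard : (mismatches X Y n t).card ≤ n :=
    (Finset.card_filter_le _ _).trans_eq (Finset.card_range n)
  have hmatch : OccursAt (charAt X Y .X) (charAt X Y .Y) t n →
      ((mismatches X Y n t).card : ℝ) ≤ 1 / r := fun h => by
    rw [mismatches_eq_empty h, Finset.card_empty, Nat.cast_zero]
    positivity
  rw [finalProb]
  split_ifs at h12 ⊢ with hcd
  · have hnofar : ∀ i, i < n → charAt X Y .X i ≠ charAt X Y .Y (t + i) →
        ∀ s ≤ 2 * K, ¬ OccursAt (charAt X Y .X) (charAt X Y .Y) s n := by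
      intro i hi hne s hs' hocc
      obtain rfl := huniq s hs' hocc
      exact hne (hocc i hi).symm
    -- Passing the test leads to `Close`, so its value is the indicator of that answer being
    -- correct.
    set v₀ : ℝ := if ((mismatches X Y n t).card : ℝ) ≤ 1 / r then 1 else 0 with hv₀
    have hgood := good_sample (w := w) (X := X) (Y := Y) (S := correctStates X Y r) (T := 4)
      (rest := [.branch 16 closeProgram farProgram]) (v₀ := v₀) (v₁ := 1) (σ := σ) (t := t)
      (by rw [hv₀]; split_ifs <;> norm_num) zero_le_one hn (by omega) hq h0 h6 h9 h10 ?_ ?_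
    · refine Good.mono (T := (4 + (q + 1) * 10 + 3) + 1 + 1)
        (Good.of_step (c' := ([.seq sampleProgram (.branch 16 closeProgram farProgram)], σ))
          (by simp [step, finalProgram, h12]) (Good.of_step rfl hgood)) (by omega) ?_
      by_cases h : ((mismatches X Y n t).card : ℝ) ≤ 1 / r
      · have := pow_pos hs.pos 3
        rw [hv₀, if_pos h]
        linarith
      · have := hs.pow_le _ hcard (not_le.1 h)
        rw [hv₀, if_neg h]
        linarith
    · intro σ' hσ' h16
      refine Good.of_step (c' := ([closeProgram], σ')) (by simp [step, h16])
        (good_close (by omega) ?_ ?_ ht ?_ fun hv => ?_)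
      · rw [hσ' 6 (by omega), h6]
      · rw [hσ' 10 (by omega), h10]
      · rw [hv₀]; split_ifs <;> norm_num
      · by_contra h
        rw [hv₀, if_neg h] at hv
        exact lt_irrefl _ hv
    · intro σ' i hσ' h16 h14 hi hne
      exact Good.of_step (c' := ([farProgram], σ')) (by simp [step, h16])
        ((good_far le_rfl fun _ => hnofar i hi hne).mono (by omega) le_rfl)
  · refine Good.mono (T := 1 + 3 + 1 + 1) (q := 1 / 2)
      (Good.of_step (c' := ([.seq (block (.arith .mul 1 10 6) [.const 16 2])
        (.instr (.rand 0 16))], σ)) (by simp [step, finalProgram, h12])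
        (Good.of_step (c' := (_ :: _ :: [], σ)) rfl ?_)) (by omega) le_rfl
    refine RunsTo.block (Post := fun σ => σ.reg 16 = 2 ∧ σ.reg 1 = t) ?_ _ _ _ _ ?_
    · simp only [wp, State.set_reg, BinOp.eval, Nat.reduceEqDiff, reduceIte, h6, h10, mul_one]
      exact ⟨by omega, by omega, trivial, trivial⟩
    rintro σ' ⟨h16, h1⟩
    by_cases hocc : OccursAt (charAt X Y .X) (charAt X Y .Y) t n
    · refine (Good.rand (q := fun i => if i = 0 then 0 else 1) (by omega) (by omega)
        (fun i _ => by split_ifs <;> norm_num) fun i hi => ?_).mono le_rfl (le_of_eq ?_)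
      · refine Good.halt 0 (by split_ifs <;> norm_num) fun hi' => ?_
        have hi0 : i ≠ 0 := by
          rintro rfl
          exact lt_irrefl _ hi'
        refine mem_correctStates_close (t := t) ?_ ?_ ht (hmatch hocc)
        · simpa only [State.set_reg, reduceIte] using hi0
        · simp only [State.set_reg, reduceIte, one_ne_zero, h1]
      · rw [h16]
        simp [Finset.sum_range_succ]
    · refine (Good.rand (q := fun i => if i = 0 then 1 else 0) (by omega) (by omega)
        (fun i _ => by split_ifs <;> norm_num) fun i hi => ?_).mono le_rfl (le_of_eq ?_)
      · refine Good.halt 0 (by split_ifs <;> norm_num) fun hi' => ?_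
        have hi0 : i = 0 := by
          by_contra h
          rw [if_neg h] at hi'
          exact lt_irrefl _ hi'
        refine mem_correctStates_far ?_ fun s hs' h => hocc ?_
        · simpa only [State.set_reg, reduceIte] using hi0
        · rwa [← huniq s hs' h]
      · rw [h16]
        simp []

/-- The observed mismatch rules out `t` and is also a position where the periodic pattern fails. The
first fact settles the case of a large period, the second starts the search for a break. -/
theorem good_mismatch {q t p i : ℕ} {δ : ℝ} (hn : 4 * K < n) (hw : 4 * (2 * K + n) + 4 < 2 ^ w)
    (hq : q + 1 < 2 ^ w) (hs : SampleBound n q r δ) (hE : Env n K a b c d (4 * K) σ)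
    (h9 : σ.reg 9 = q + 1) (h10 : σ.reg 10 = t) (h11 : σ.reg 11 = p)
    (h12 : σ.reg 12 = if 3 * c < 2 * d then 1 else 0) (hr : 0 < r) (ht : t ≤ 2 * K)
    (hp : IsMinPer (charAt X Y .X) p (4 * K))
    (hocc : OccursAt (charAt X Y .X) (charAt X Y .Y) t (4 * K))
    (hmin : ∀ e < t, ¬ OccursAt (charAt X Y .X) (charAt X Y .Y) e (4 * K))
    (h14 : σ.reg 14 = i) (hi : i < n) (hne : charAt X Y .X i ≠ charAt X Y .Y (t + i)) :
    Good w X Y (correctStates X Y r)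
      ((q + 1) * 10 + (Nat.log 2 n + 4) * (120 * K) + 40) (finalProb c d δ)
      ([mismatchProgram], σ) := by
  refine Good.mono (T := (q + 1) * 10 + (Nat.log 2 n + 4) * (120 * K) + 30 + 1 + 1 + 1)
    (Good.of_step (c' := (_ :: _ :: [], σ)) rfl ?_) (by omega) le_rfl
  refine RunsTo.block (Post := fun σ' => (∀ r < 17, r ≠ 13 → σ'.reg r = σ.reg r) ∧
    σ'.reg 13 = if 2 * K < p then 1 else 0) ?_ _ _ _ _ ?_
  · simp only [wp, State.set_reg, BinOp.eval, reduceIte, hE.h7, h11]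
    refine ⟨by split_ifs <;> omega, fun r hr hr' => by rw [if_neg hr'], trivial⟩
  rintro σ' ⟨hσ', h13⟩
  by_cases hpK : 2 * K < p
  · refine Good.of_step (c' := ([farProgram], σ')) (by simp [step, h13, hpK]) ?_
    refine (good_far (finalProb_le_one hs.pos) fun _ s hs' hocc' => ?_).mono (by omega) le_rfl
    have hocc'' : OccursAt (charAt X Y .X) (charAt X Y .Y) s (4 * K) :=
      fun k hk => hocc' k (by omega)
    rcases lt_trichotomy s t with h | rfl | h
    · exact hmin s h hocc''
    · exact hne (hocc' i hi).symm
    -- A later match would give the period `s - t ≤ 2 * K < p`.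
    · exact hp.2.2 (s - t) (by omega) (by omega) (hocc.isPer_sub hocc'' h.le)
  · have hK : 1 ≤ K := by
      have := hp.1
      omega
    have hE' : Env n K a b c d (4 * K) σ' := hE.of_eq fun r hr => hσ' r (by omega) (by omega)
    have hnot : ¬ Follows (charAt X Y .X) (charAt X Y .Y) p t i := fun h => hne (h.1.trans h.2.symm)
    -- The mismatch lies beyond the prefix, which occurs at `t` and is regular throughout.
    have hmi : 4 * K ≤ i := by
      by_contra h
      exact hnot (follows_of_lt hp.2.1 hocc (by omega))
    have hrun : RunsTo w X Y (.seq breakProgram scanProgram) σ'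
        ((Nat.log 2 n + 4) * (120 * K) + 1) fun τ => (∀ r < 17, r ≠ 10 → τ.reg r = σ'.reg r) ∧
          ∃ u, τ.reg 10 = u ∧ u ≤ 2 * K ∧
            ∀ s ≤ 2 * K, OccursAt (charAt X Y .X) (charAt X Y .Y) s n → s = u := by
      refine (RunsTo.seq (t := (Nat.log 2 n + 3) * (40 * (K + 2))) (t' := 40 * (K + 2))
        ?_).mono ?_ fun _ h => h
      · refine (runsTo_break (by omega) hE' ((hσ' 10 (by omega) (by omega)).trans h10)
          ((hσ' 11 (by omega) (by omega)).trans h11) ((hσ' 14 (by omega) (by omega)).trans h14)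
          hmi hi hK (by omega) (fun j hj => follows_of_lt hp.2.1 hocc hj) hnot).mono le_rfl ?_
        rintro τ ⟨hτ, l, h17, hl1, hl2, hl3, hl4⟩
        refine (runsTo_scan (p := p) (t := t) (l := l) (by omega)
          (hE'.of_eq fun r hr => hτ r (by omega)) ?_ ?_ h17 ht).mono le_rfl ?_
        · rw [hτ 10 (by omega), hσ' 10 (by omega) (by omega), h10]
        · rw [hτ 11 (by omega), hσ' 11 (by omega) (by omega), h11]
        rintro ρ ⟨hρ, u, hu10, htu, huK, hscan, hlast⟩
        refine ⟨fun r hr hr' => (hρ r hr hr').trans (hτ r hr), u, hu10, huK, fun s hsK hsocc => ?_⟩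
        have e : 2 * (2 * K) = 4 * K := by ring
        exact eq_of_occursAt_of_break (M := 2 * K) (n := n) (l := l) (e ▸ hp) (by omega)
          (e ▸ hocc) (e ▸ hmin) (by omega) (by omega) hl2 hl3 hl4 htu hscan hlast hsocc hsK
      · have := Nat.mul_le_mul_left (Nat.log 2 n + 4) (show 40 * (K + 2) ≤ 120 * K by omega)
        have e : (Nat.log 2 n + 4) * (40 * (K + 2)) =
          (Nat.log 2 n + 3) * (40 * (K + 2)) + 40 * (K + 2) := by ring
        omega
    refine Good.of_step (c' := ([.seq (.seq breakProgram scanProgram) finalProgram], σ'))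
      (by simp [step, h13, hpK]) (Good.of_step (c' := (_ :: _ :: [], σ')) rfl ?_)
    refine Good.mono (T := (q + 1) * 10 + 20 + ((Nat.log 2 n + 4) * (120 * K) + 1))
      (hrun _ _ _ _ ?_) (by omega) le_rfl
    rintro τ ⟨hτ, u, h10', huK, huniq⟩
    have hτ' : ∀ r < 13, r ≠ 10 → τ.reg r = σ.reg r := fun r hr hr' =>
      (hτ r (by omega) hr').trans (hσ' r (by omega) (by omega))
    refine good_final (t := u) (by omega) (by omega) hq hs ?_ ?_ ?_ h10' ?_ hr huK huniq
    · rw [hτ' 0 (by omega) (by omega), hE.h0]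
    · rw [hτ' 6 (by omega) (by omega), hE.h6]
    · rw [hτ' 9 (by omega) (by omega), h9]
    · rw [hτ' 12 (by omega) (by omega), h12]

/-- For `δ < 2 / 3` this is `1 - 2 * δ ^ 2 + δ ^ 5 ≥ 0`, multiplied by `δ`. For `δ ≥ 2 / 3` the
difference of the sides is `(1 - δ) * (δ ^ 2 + δ - 1) / 2`, which is nonnegative there. -/
theorem mul_finalProb_ge {δ : ℝ} (hδ : 0 < δ) (hδ1 : δ < 1) (hδcd : δ = c / d) (hd : 0 < d) :
    1 - δ ≤ (1 - δ ^ 3) * finalProb c d δ := by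
  have hd' : (0 : ℝ) < d := by exact_mod_cast hd
  rw [finalProb]
  split_ifs with h
  · have h1 : (3 : ℝ) * c < 2 * d := by exact_mod_cast h
    have h2 : 3 * δ < 2 := by
      rw [hδcd, ← mul_div_assoc, div_lt_iff₀ hd']
      exact h1
    nlinarith [mul_pos hδ hδ, mul_pos (mul_pos hδ hδ) hδ, pow_pos hδ 3, pow_pos hδ 6]
  · have h1 : (2 : ℝ) * d ≤ 3 * c := by exact_mod_cast not_lt.1 h
    have h2 : 2 ≤ 3 * δ := by
      rw [hδcd, ← mul_div_assoc, le_div_iff₀ hd']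
      exact h1
    have h3 : 0 ≤ (1 - δ) * (δ ^ 2 + δ - 1) := mul_nonneg (by linarith) (by nlinarith)
    nlinarith

/-- If `t` is acceptable, passing is right and failing still leaves `finalProb`. If it is not,
passing is wrong but has probability at most `δ ^ 3`. Both cases give at least `(1 - δ ^ 3) *
finalProb c d δ`. -/
theorem good_long {q t k B : ℕ} {δ : ℝ} (hn : 4 * K < n) (hB : n + 2 * K + a + b + c + d ≤ B)
    (hB4 : 4 ≤ B) (hBw : B ^ 6 ≤ 2 ^ w) (hlin : 64 * B ≤ 2 ^ w)
    (hk : d ≤ c * 2 ^ k) (hkd : k ≤ d) (hkmin : ∀ j < k, c * 2 ^ j < d)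
    (hqs : sampleCount n a b c d k = q + 1) (hs : SampleBound n q r δ) (hδ : δ = c / d)
    (hE : Env n K a b c d (4 * K) σ) (h10 : σ.reg 10 = t) (hr : 0 < r) (ht : t ≤ 2 * K)
    (hp : IsMinPer (charAt X Y .X) (σ.mem (4 * K)) (4 * K))
    (hocc : OccursAt (charAt X Y .X) (charAt X Y .Y) t (4 * K))
    (hmin : ∀ e < t, ¬ OccursAt (charAt X Y .X) (charAt X Y .Y) e (4 * K)) :
    Good w X Y (correctStates X Y r) ((q + 1) * 20 + (Nat.log 2 n + 4) * (120 * K) +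
      (if 3 * c < 2 * d then k * 8 else 0) + 200) (1 - δ) ([longProgram], σ) := by
  have hd : 0 < d := by
    rcases Nat.eq_zero_or_pos d with rfl | hd
    · have := hs.pos
      rw [hδ] at this
      simp at this
    · exact hd
  set p := σ.mem (4 * K) with hpdef
  have hp1 := hp.le
  set z : ℝ := 1 - (mismatches X Y n t).card / n with hz
  have hcard : (mismatches X Y n t).card ≤ n :=
    (Finset.card_filter_le _ _).trans_eq (Finset.card_range n)
  set β := finalProb c d δ with hβ
  have hβ0 : 0 ≤ β := finalProb_nonneg hs.pos hs.lt_one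
  have hβ1 : β ≤ 1 := finalProb_le_one hs.pos
  have hδβ := mul_finalProb_ge hs.pos hs.lt_one hδ hd
  have hδ3 := pow_pos hs.pos 3
  refine Good.mono (T := (q + 1) * 20 + (Nat.log 2 n + 4) * (120 * K) + 60 +
    ((if 3 * c < 2 * d then k * 8 else 0) + 100) + 1 + 1 + 1) (q := 1 - δ)
    (Good.of_step (c' := (_ :: _ :: [], σ)) rfl ?_) (by omega) le_rfl
  refine RunsTo.block (Post := fun σ' => (∀ r < 11, σ'.reg r = σ.reg r) ∧ σ'.reg 11 = p) ?_
    _ _ _ _ ?_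
  · simp only [wp, State.set_reg, reduceIte, hE.h8]
    exact ⟨by omega, fun r hr => by rw [if_neg (by omega)], rfl⟩
  rintro σ₁ ⟨hσ₁, h11⟩
  have hE₁ : Env n K a b c d (4 * K) σ₁ := hE.of_eq fun r hr => hσ₁ r (by omega)
  refine Good.of_step (c' := (_ :: _ :: [], σ₁)) rfl ?_
  refine runsTo_rate hB4 hBw (by omega) (by omega) hE₁ hk hkd hkmin _ _ _ _ ?_
  rintro σ₂ ⟨hσ₂, h9, hqw, h12⟩
  rw [hqs] at h9 hqw
  have hE₂ : Env n K a b c d (4 * K) σ₂ := hE₁.of_eq fun r hr => hσ₂ r (by omega) (by omega)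
  have h10₂ : σ₂.reg 10 = t := by
    rw [hσ₂ 10 (by omega) (by omega), hσ₁ 10 (by omega), h10]
  have h11₂ : σ₂.reg 11 = p := by rw [hσ₂ 11 (by omega) (by omega), h11]
  set v₀ : ℝ := if ((mismatches X Y n t).card : ℝ) ≤ 1 / r then 1 else 0 with hv₀
  have hgood := good_sample (w := w) (X := X) (Y := Y) (S := correctStates X Y r)
    (T := (q + 1) * 10 + (Nat.log 2 n + 4) * (120 * K) + 40 + 1)
    (rest := [.branch 16 closeProgram mismatchProgram]) (v₀ := v₀) (v₁ := β) (σ := σ₂) (t := t)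
    (by rw [hv₀]; split_ifs <;> norm_num) hβ0 (by omega) (by omega) hqw hE₂.h0 hE₂.h6 h9 h10₂ ?_ ?_
  · refine Good.mono (Good.of_step (c' := (_ :: _ :: [], σ₂)) rfl hgood) (by omega) ?_
    by_cases h : ((mismatches X Y n t).card : ℝ) ≤ 1 / r
    · have hn0 : (0 : ℝ) < n := by exact_mod_cast (by omega : 0 < n)
      have hz0 : 0 ≤ z := by
        rw [hz, sub_nonneg, div_le_one hn0]
        exact_mod_cast hcard
      have hzq := pow_nonneg hz0 (q + 1)
      rw [hv₀, if_pos h]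
      nlinarith
    · have := hs.pow_le _ hcard (not_le.1 h)
      rw [hv₀, if_neg h]
      nlinarith
  · intro σ' hσ' h16
    refine (Good.of_step (c' := ([closeProgram], σ')) (by simp [step, h16])
      (good_close (by omega) ?_ ?_ ht ?_ fun hv => ?_)).mono (by omega) le_rfl
    · rw [hσ' 6 (by omega), hE₂.h6]
    · rw [hσ' 10 (by omega), h10₂]
    · rw [hv₀]; split_ifs <;> norm_num
    · by_contra h
      rw [hv₀, if_neg h] at hv
      exact lt_irrefl _ hv
  · intro σ' i hσ' h16 h14 hi hne
    refine Good.of_step (c' := ([mismatchProgram], σ')) (by simp [step, h16])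
      (good_mismatch hn (by omega) hqw hs (hE₂.of_eq fun r hr => hσ' r (by omega)) ?_ ?_ ?_ ?_ hr
        ht hp hocc hmin h14 hi hne)
    · rw [hσ' 9 (by omega), h9]
    · rw [hσ' 10 (by omega), h10₂]
    · rw [hσ' 11 (by omega), h11₂]
    · rw [hσ' 12 (by omega), h12]

theorem good_main {q k B : ℕ} {δ : ℝ} (hB : n + 2 * K + a + b + c + d ≤ B)
    (hB4 : 4 ≤ B) (hBw : B ^ 6 ≤ 2 ^ w) (hlin : 64 * B ≤ 2 ^ w)
    (hk : d ≤ c * 2 ^ k) (hkd : k ≤ d) (hkmin : ∀ j < k, c * 2 ^ j < d)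
    (hqs : sampleCount n a b c d k = q + 1) (hs : SampleBound n q r δ) (hδ : δ = c / d)
    (hr : 0 < r) (h0 : σ.reg 0 = n) (h1 : σ.reg 1 = K) (h2 : σ.reg 2 = a) (h3 : σ.reg 3 = b)
    (h4 : σ.reg 4 = c) (h5 : σ.reg 5 = d) (h6 : σ.reg 6 = 1) :
    Good w X Y (correctStates X Y r) ((q + 1) * 20 + (Nat.log 2 n + 4) * (120 * K) +
      (if 3 * c < 2 * d then k * 8 else 0) + 480 * K + 500) (1 - δ) ([mainProgram], σ) := by
  have hδ0 := hs.pos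
  -- Truncated subtraction makes this `min n (4 * K)`.
  set m := 4 * K - (4 * K - n) with hm
  set Tl := (q + 1) * 20 + (Nat.log 2 n + 4) * (120 * K) +
      (if 3 * c < 2 * d then k * 8 else 0) + 200 with hTl
  refine Good.mono (T := Tl + 10 + 40 * (m + 4 * K + 2) + 1 + 40 * (m + 1) + 1 + 7 + 1) (q := 1 - δ)
    (Good.of_step (c' := (_ :: _ :: [], σ)) rfl ?_) (by omega) le_rfl
  refine RunsTo.block (Post := fun σ' => Env n K a b c d m σ') ?_ _ _ _ _ ?_
  · simp only [wp, State.set_reg, BinOp.eval, Nat.reduceEqDiff, reduceIte, h0, h1]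
    refine ⟨by omega, by omega, by omega, by omega, ?_⟩
    constructor <;>
    simp only [State.set_reg, Nat.reduceEqDiff, reduceIte, h0, h1, h2, h3, h4, h5, h6] <;>
    omega
  intro σ₁ hE₁
  refine Good.of_step (c' := (_ :: _ :: [], σ₁)) rfl ?_
  refine runsTo_periods (by omega) hE₁ _ _ _ _ ?_
  rintro σ₂ ⟨hE₂, hper⟩
  refine Good.of_step (c' := (_ :: _ :: [], σ₂)) rfl ?_
  refine runsTo_search (by omega) hE₂ hper _ _ _ _ ?_
  rintro σ₃ ⟨hE₃, hmem, t, h10, htw, hmin, hocc⟩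
  refine Good.mono (T := Tl + 6 + 1 + 1 + 1) (q := 1 - δ)
    (Good.of_step (c' := (_ :: _ :: [], σ₃)) rfl ?_) (by omega) le_rfl
  refine RunsTo.block (Post := fun σ' => (∀ r < 16, σ'.reg r = σ₃.reg r) ∧ σ'.mem = σ₃.mem ∧
    σ'.reg 16 = if 2 * K < t then 1 else 0) ?_ _ _ _ _ ?_
  · simp only [wp, State.set_reg, State.set_mem, BinOp.eval, reduceIte, hE₃.h7, h10]
    exact ⟨by split_ifs <;> omega, fun r hr => by rw [if_neg (by omega)], trivial, trivial⟩
  rintro σ₄ ⟨hσ₄, hmem₄, h16⟩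
  by_cases ht : 2 * K < t
  · refine Good.of_step (c' := ([farProgram], σ₄)) (by simp [step, h16, ht]) ?_
    exact (good_far (by linarith) fun _ s hs' hocc' =>
      hmin s (by omega) fun i hi => hocc' i (by omega)).mono (by omega) le_rfl
  rw [not_lt] at ht
  have hE₄ : Env n K a b c d m σ₄ := hE₃.of_eq fun r hr => hσ₄ r (by omega)
  have h10₄ : σ₄.reg 10 = t := by rw [hσ₄ 10 (by omega), h10]
  refine Good.of_step (c' := ([.seq (block (.arith .add 13 7 7) [.arith .lt 16 13 0])
    (.branch 16 longProgram closeProgram)], σ₄)) (by simp [step, h16, ht]) ?_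
  refine Good.mono (T := Tl + 1 + 3 + 1) (q := 1 - δ)
    (Good.of_step (c' := (_ :: _ :: [], σ₄)) rfl ?_) (by omega) le_rfl
  refine RunsTo.block (Post := fun σ' => (∀ r < 13, σ'.reg r = σ₄.reg r) ∧ σ'.mem = σ₄.mem ∧
    σ'.reg 16 = if 4 * K < n then 1 else 0) ?_ _ _ _ _ ?_
  · simp only [wp, State.set_reg, State.set_mem, BinOp.eval, Nat.reduceEqDiff, reduceIte, hE₄.h7,
      hE₄.h0]
    refine ⟨by omega, by split_ifs <;> omega, fun r hr => ?_, trivial, ?_⟩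
    · rw [if_neg (by omega), if_neg (by omega)]
    · rw [show 2 * K + 2 * K = 4 * K by ring]
  rintro σ₅ ⟨hσ₅, hmem₅, h16₅⟩
  have hE₅ : Env n K a b c d m σ₅ := hE₄.of_eq fun r hr => hσ₅ r (by omega)
  have h10₅ : σ₅.reg 10 = t := by rw [hσ₅ 10 (by omega), h10₄]
  by_cases hn : 4 * K < n
  · have hm4 : m = 4 * K := by omega
    rw [hm4] at hE₅ hocc hmin hper
    refine Good.of_step (c' := ([longProgram], σ₅)) (by simp [step, h16₅, hn]) ?_
    refine good_long hn hB hB4 hBw hlin hk hkd hkmin hqs hs hδ hE₅ h10₅ hr ht ?_ (hocc ht) hmin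
    rw [hmem₅, hmem₄, hmem]
    exact hper _ le_rfl
  · have hmn : m = n := by omega
    rw [hmn] at hocc
    refine Good.of_step (c' := ([closeProgram], σ₅)) (by simp [step, h16₅, hn]) ?_
    refine (good_close (by omega) hE₅.h6 h10₅ ht (by linarith) fun _ => ?_).mono (by omega) le_rfl
    rw [mismatches_eq_empty (hocc ht), Finset.card_empty, Nat.cast_zero]
    positivity

end Correctness

theorem exists_min_pow {c d : ℕ} (hc : 0 < c) :
    ∃ k, d ≤ c * 2 ^ k ∧ k ≤ d ∧ ∀ j < k, c * 2 ^ j < d := by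
  have hd : d ≤ c * 2 ^ d := (Nat.lt_two_pow_self (n := d)).le.trans (Nat.le_mul_of_pos_left _ hc)
  have hex : ∃ k, d ≤ c * 2 ^ k := ⟨d, hd⟩
  exact ⟨Nat.find hex, Nat.find_spec hex, Nat.find_min' hex hd,
    fun j hj => not_le.1 (Nat.find_min hex hj)⟩

/-! ### Logarithm estimates for the sample size and the running time -/

section Estimates

variable {n a b c d k : ℕ}

/-- The number of samples is three times the rate times this number. -/
noncomputable def logBound (c d k : ℕ) : ℝ :=
  ((if 3 * c < 2 * d then k else d - c : ℕ) : ℝ) / ((if 3 * c < 2 * d then 1 else c : ℕ) : ℝ)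

/-- One branch uses `log 2 ≤ 1`, the other `log x ≤ x - 1` at `x = d / c`. -/
theorem log_le_logBound (hc : 0 < c) (hcd : c < d) (hk : d ≤ c * 2 ^ k) :
    Real.log ((d : ℝ) / c) ≤ logBound c d k := by
  have hc' : (0 : ℝ) < c := by exact_mod_cast hc
  have hd' : (0 : ℝ) < d := by exact_mod_cast hc.trans hcd
  rw [logBound]
  split_ifs
  · have h1 : (d : ℝ) / c ≤ 2 ^ k := by
      rw [div_le_iff₀ hc', mul_comm]
      exact_mod_cast hk
    have h2 := Real.log_le_log (by positivity) h1
    rw [Real.log_pow] at h2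
    have h3 : (k : ℝ) * Real.log 2 ≤ k * 1 :=
      mul_le_mul_of_nonneg_left (by linarith [Real.log_two_lt_d9]) (Nat.cast_nonneg k)
    rw [Nat.cast_one, div_one]
    linarith
  · have h1 := Real.log_le_sub_one_of_pos (show (0 : ℝ) < d / c by positivity)
    rw [Nat.cast_sub hcd.le, sub_div, div_self hc'.ne']
    exact h1

/-- The reason for two branches: `k` is at least `1` and useless for `d / c` near `1`, where `d / c
- 1` is comparable to the logarithm. In the first branch `log (d / c) ≥ 1 / 3` absorbs the rounding
of `k`, giving `2 + 3 = 5`. -/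
theorem logBound_le (hc : 0 < c) (hcd : c < d) (hmin : ∀ j < k, c * 2 ^ j < d) :
    logBound c d k ≤ 5 * Real.log ((d : ℝ) / c) := by
  have hc' : (0 : ℝ) < c := by exact_mod_cast hc
  have hd' : (0 : ℝ) < d := by exact_mod_cast hc.trans hcd
  rw [logBound]
  split_ifs with h
  · have h' : (3 : ℝ) * c < 2 * d := by exact_mod_cast h
    have h1 : (1 : ℝ) / 3 ≤ Real.log ((d : ℝ) / c) := by
      have h2 := Real.one_sub_inv_le_log_of_pos (show (0 : ℝ) < d / c by positivity)
      have h3 : ((d : ℝ) / c)⁻¹ ≤ 2 / 3 := by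
        rw [inv_div, div_le_div_iff₀ hd' (by norm_num)]
        linarith
      linarith
    rw [Nat.cast_one, div_one]
    rcases k with _ | k
    · rw [Nat.cast_zero]
      linarith
    · have h2 : (2 : ℝ) ^ k ≤ (d : ℝ) / c := by
        rw [le_div_iff₀ hc', mul_comm]
        exact_mod_cast (hmin k (Nat.lt_succ_self k)).le
      have h3 := Real.log_le_log (by positivity) h2
      rw [Real.log_pow] at h3
      have h4 : (k : ℝ) * (1 / 2) ≤ k * Real.log 2 :=
        mul_le_mul_of_nonneg_left (by linarith [Real.log_two_gt_d9]) (Nat.cast_nonneg k)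
      push_cast
      linarith
  · have h' : (2 : ℝ) * d ≤ 3 * c := by exact_mod_cast not_lt.1 h
    have h2 := Real.one_sub_inv_le_log_of_pos (show (0 : ℝ) < d / c by positivity)
    refine le_trans ?_ (mul_le_mul_of_nonneg_left h2 (by norm_num))
    have hcd' : (c : ℝ) < d := by exact_mod_cast hcd
    rw [Nat.cast_sub hcd.le, inv_div, one_sub_div hd'.ne', mul_div_assoc',
      div_le_div_iff₀ hc' hd']
    nlinarith

theorem sampleCount_ge (hb : 0 < b) (hc : 0 < c) :
    3 * ((a : ℝ) / b * n) * logBound c d k ≤ sampleCount n a b c d k := by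
  have hden : 0 < if 3 * c < 2 * d then 1 else c := by split_ifs <;> omega
  rw [sampleCount, logBound]
  generalize (if 3 * c < 2 * d then k else d - c) = num
  generalize (if 3 * c < 2 * d then 1 else c) = den at hden
  have h := (Nat.lt_div_mul_add (a := 3 * a * n * num) (Nat.mul_pos hb hden)).le
  rw [← Nat.succ_mul] at h
  have hb' : (0 : ℝ) < b := by exact_mod_cast hb
  have hden' : (0 : ℝ) < den := by exact_mod_cast hden
  have h' : (3 * a * n * num : ℝ) ≤
      ((3 * a * n * num / (b * den) + 1 : ℕ) : ℝ) * (b * den) := by exact_mod_cast h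
  have e : 3 * ((a : ℝ) / b * n) * (num / den) = 3 * a * n * num / (b * den) := by
    field_simp
  rw [e, div_le_iff₀ (by positivity)]
  exact h'

theorem sampleCount_le (hb : 0 < b) (hc : 0 < c) :
    (sampleCount n a b c d k : ℝ) ≤ 3 * ((a : ℝ) / b * n) * logBound c d k + 1 := by
  have hden : 0 < if 3 * c < 2 * d then 1 else c := by split_ifs <;> omega
  rw [sampleCount, logBound]
  generalize (if 3 * c < 2 * d then k else d - c) = num
  generalize (if 3 * c < 2 * d then 1 else c) = den at hden
  have hb' : (0 : ℝ) < b := by exact_mod_cast hb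
  have hden' : (0 : ℝ) < den := by exact_mod_cast hden
  have h := Nat.cast_div_le (α := ℝ) (m := 3 * a * n * num) (n := b * den)
  have e : 3 * ((a : ℝ) / b * n) * (num / den) = 3 * a * n * num / (b * den) := by
    field_simp
  rw [e]
  push_cast at h ⊢
  linarith

/-- By `1 - x ≤ exp (-x)` the probability is at most `exp (-(q + 1) * h / n)`. The sample size is at
least `3 * (a / b) * n * log (d / c)` and `h * (a / b) ≥ 1`, so the exponent is at most `-3 * log (d
/ c)`. -/
theorem sampleBound {q : ℕ} (ha : 0 < a) (hb : 0 < b) (hn : 0 < n) (hc : 0 < c) (hcd : c < d)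
    (hk : d ≤ c * 2 ^ k) (hq : sampleCount n a b c d k = q + 1) :
    SampleBound n q ((a : ℝ) / b) ((c : ℝ) / d) := by
  have ha' : (0 : ℝ) < a := by exact_mod_cast ha
  have hb' : (0 : ℝ) < b := by exact_mod_cast hb
  have hn' : (0 : ℝ) < n := by exact_mod_cast hn
  have hc' : (0 : ℝ) < c := by exact_mod_cast hc
  have hd' : (0 : ℝ) < d := by exact_mod_cast hc.trans hcd
  refine ⟨by positivity, ?_, fun h hhn hh => ?_⟩
  · rw [div_lt_one hd']
    exact_mod_cast hcd
  · have h1 : 1 - (h : ℝ) / n ≤ Real.exp (-(h / n)) := by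
      have := Real.add_one_le_exp (-((h : ℝ) / n))
      linarith
    have h0 : 0 ≤ 1 - (h : ℝ) / n := by
      rw [sub_nonneg, div_le_one hn']
      exact_mod_cast hhn
    refine (pow_le_pow_left₀ h0 h1 (q + 1)).trans ?_
    rw [← Real.exp_nat_mul, ← Real.exp_log (show 0 < ((c : ℝ) / d) ^ 3 by positivity),
      Real.exp_le_exp, Real.log_pow, ← inv_div (d : ℝ) c, Real.log_inv]
    have h2 := sampleCount_ge (n := n) (a := a) (d := d) (k := k) hb hc
    rw [hq] at h2
    have h3 := log_le_logBound hc hcd hk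
    have h4 : 3 * ((a : ℝ) / b * n) * Real.log ((d : ℝ) / c) ≤ ((q + 1 : ℕ) : ℝ) :=
      (mul_le_mul_of_nonneg_left h3 (by positivity)).trans h2
    have h5 : 1 ≤ (h : ℝ) * (a / b) := by
      rw [div_lt_iff₀ (by positivity)] at hh
      exact hh.le
    have h6 : 0 ≤ Real.log ((d : ℝ) / c) := by
      refine Real.log_nonneg ?_
      rw [le_div_iff₀ hc', one_mul]
      exact_mod_cast hcd.le
    have h7 : 3 * Real.log ((d : ℝ) / c) ≤ ((q + 1 : ℕ) : ℝ) * (h / n) := by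
      calc 3 * Real.log ((d : ℝ) / c)
          ≤ 3 * Real.log ((d : ℝ) / c) * ((h : ℝ) * (a / b)) :=
            le_mul_of_one_le_right (by positivity) h5
        _ = 3 * ((a : ℝ) / b * n) * Real.log ((d : ℝ) / c) * (h / n) := by
            field_simp
        _ ≤ _ := mul_le_mul_of_nonneg_right h4 (by positivity)
    push_cast at h7 ⊢
    linarith

theorem natLog_add_le (hn : 0 < n) :
    ((Nat.log 2 n : ℕ) : ℝ) + 4 ≤ 10 * Real.log (n + 1) ∧ 1 ≤ 2 * Real.log (n + 1) := by
  have hn' : (1 : ℝ) ≤ n := by exact_mod_cast hn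
  have h1 : (2 : ℝ) ^ Nat.log 2 n ≤ n + 1 := by
    have := Nat.pow_log_le_self 2 hn.ne'
    exact_mod_cast this.trans (Nat.le_succ n)
  have h2 := Real.log_le_log (by positivity) h1
  rw [Real.log_pow] at h2
  have h3 : Real.log 2 ≤ Real.log (n + 1) := Real.log_le_log (by norm_num) (by linarith)
  have h4 := Real.log_two_gt_d9
  have h5 : ((Nat.log 2 n : ℕ) : ℝ) * (1 / 2) ≤ (Nat.log 2 n : ℕ) * Real.log 2 :=
    mul_le_mul_of_nonneg_left (by linarith) (Nat.cast_nonneg _)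
  constructor <;> linarith

theorem time_le {K q : ℕ} {r δ : ℝ} (hr : 0 < r) (hδ : 0 < δ) (hδ1 : δ < 1) (hb : 0 < b)
    (har : (a : ℝ) / b ≤ 2 * r) (hc : 0 < c) (hcd : c < d) (hδc : δ ^ 2 ≤ (c : ℝ) / d)
    (han : b < a * n) (hmin : ∀ j < k, c * 2 ^ j < d)
    (hq : sampleCount n a b c d k = q + 1) :
    (((q + 1) * 20 + (Nat.log 2 n + 4) * (120 * K) +
      (if 3 * c < 2 * d then k * 8 else 0) + 480 * K + 510 : ℕ) : ℝ) ≤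
      (4000 : ℕ) * (r * n * Real.log (1 / δ) + K * Real.log (n + 1) + 1) := by
  have hn : 0 < n := Nat.pos_of_ne_zero (by rintro rfl; omega)
  have hb' : (0 : ℝ) < b := by exact_mod_cast hb
  have hc' : (0 : ℝ) < c := by exact_mod_cast hc
  have hd' : (0 : ℝ) < d := by exact_mod_cast hc.trans hcd
  have hn' : (0 : ℝ) < n := by exact_mod_cast hn
  set ℓ := Real.log (1 / δ) with hℓ
  have hℓ0 : 0 ≤ ℓ := Real.log_nonneg (by rw [le_div_iff₀ hδ]; linarith)
  have hlog : Real.log ((d : ℝ) / c) ≤ 2 * ℓ := by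
    have h1 : (d : ℝ) / c ≤ (1 / δ) ^ 2 := by
      rw [one_div_pow, ← inv_div, ← one_div]
      exact one_div_le_one_div_of_le (by positivity) hδc
    have h2 := Real.log_le_log (by positivity) h1
    rw [Real.log_pow] at h2
    exact_mod_cast h2
  have hL := logBound_le hc hcd hmin
  have hL0 : 0 ≤ logBound c d k := by
    rw [logBound]
    positivity
  -- The nontrivial rate is needed here: it charges the time for computing `k`, of order `log (1 /
  -- δ)`, to the sampling term.
  have hrn : 1 ≤ 2 * (r * n) := by
    have h1 : (b : ℝ) < a * n := by exact_mod_cast han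
    have h2 : 1 ≤ (a : ℝ) / b * n := by
      rw [div_mul_eq_mul_div, le_div_iff₀ hb']
      linarith
    nlinarith
  have hcount := sampleCount_le (n := n) (a := a) (d := d) (k := k) hb hc
  rw [hq] at hcount
  -- `60 = 3 * 2 * 10`: the sample factor, `a / b ≤ 2 * r`, and `logBound ≤ 5 * log (d / c) ≤ 10 *
  -- ℓ`.
  have hq' : ((q + 1 : ℕ) : ℝ) ≤ 60 * (r * n * ℓ) + 1 := by
    have h1 : 3 * ((a : ℝ) / b * n) * logBound c d k ≤ 3 * (2 * r * n) * (10 * ℓ) := by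
      refine mul_le_mul ?_ (by linarith) hL0 (by positivity)
      exact mul_le_mul_of_nonneg_left (mul_le_mul_of_nonneg_right har hn'.le) (by norm_num)
    linarith
  have hk' : ((if 3 * c < 2 * d then k * 8 else 0 : ℕ) : ℝ) ≤ 160 * (r * n * ℓ) := by
    have h1 : ℓ ≤ 2 * (r * n) * ℓ := le_mul_of_one_le_left hℓ0 hrn
    rw [logBound] at hL
    split_ifs at hL ⊢
    · rw [Nat.cast_one, div_one] at hL
      push_cast
      linarith
    · rw [Nat.cast_zero]
      positivity
  obtain ⟨h1, h2⟩ := natLog_add_le hn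
  have hK1 : (K : ℝ) * ((Nat.log 2 n : ℕ) + 4) ≤ K * (10 * Real.log (n + 1)) :=
    mul_le_mul_of_nonneg_left h1 (Nat.cast_nonneg K)
  have hK2 : (K : ℝ) * 1 ≤ K * (2 * Real.log (n + 1)) :=
    mul_le_mul_of_nonneg_left h2 (Nat.cast_nonneg K)
  have hpos : 0 ≤ (K : ℝ) * Real.log (n + 1) := by linarith [Nat.cast_nonneg (α := ℝ) K]
  have hpos2 : 0 ≤ r * n * ℓ := by positivity
  push_cast at hq' ⊢
  push_cast at hk'
  linarith

end Estimates

end WordRAM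

theorem lemma13 :
    ∃ (P : WordRAM.Program) (κ C : ℕ),
      ∀ (α : Type*) [DecidableEq α] (n K : ℕ) (X : Fin n → α) (Y : Fin (n + 2 * K) → α)
        (r δ : ℝ) (a b c d w : ℕ),
        0 < r → 0 < δ → δ < 1 →
        0 < b → r ≤ (a : ℝ) / b → (a : ℝ) / b ≤ 2 * r →
        0 < d → δ ^ 2 ≤ (c : ℝ) / d → (c : ℝ) / d ≤ δ →
        (n + 2 * K + a + b + c + d) ^ κ ≤ 2 ^ w →
        ∃ T : ℕ,
          (T : ℝ) ≤ C * (r * n * Real.log (1 / δ) + K * Real.log (n + 1) + 1) ∧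
          (∀ cfg ∈ (WordRAM.run w X Y T ([P], WordRAM.init w [n, K, a, b, c, d])).support, cfg.1 = []) ∧
          ENNReal.ofReal (1 - δ) ≤
            (WordRAM.run w X Y T ([P], WordRAM.init w [n, K, a, b, c, d])).toOuterMeasure
              {cfg | (WordRAM.answer K cfg.2).Correct X Y r} := by
  refine ⟨WordRAM.matchingProgram, 6, 4000, ?_⟩
  intro α _ n K X Y r δ a b c d w hr hδ hδ1 hb hra har hd hδc hcδ hw
  have hb' : (0 : ℝ) < b := by exact_mod_cast hb
  have hd' : (0 : ℝ) < d := by exact_mod_cast hd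
  have hr' : 0 < (a : ℝ) / b := hr.trans_le hra
  have ha : 0 < a := by
    rcases Nat.eq_zero_or_pos a with rfl | ha
    · simp at hr'
    · exact ha
  have hδ' : 0 < (c : ℝ) / d := (pow_pos hδ 2).trans_le hδc
  have hc : 0 < c := by
    rcases Nat.eq_zero_or_pos c with rfl | hc
    · simp at hδ'
    · exact hc
  have hcd : c < d := by
    have := (div_lt_one hd').1 (hcδ.trans_lt hδ1)
    exact_mod_cast this
  set B := n + 2 * K + a + b + c + d with hB
  have hB4 : 4 ≤ B := by omega
  have hlin : 64 * B ≤ 2 ^ w := by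
    refine le_trans ?_ hw
    calc 64 * B ≤ B ^ 3 * B := Nat.mul_le_mul_right _ (Nat.pow_le_pow_left hB4 3)
      _ = B ^ 4 := by ring
      _ ≤ B ^ 6 := Nat.pow_le_pow_right (by omega) (by omega)
  have han : 2 * (a * n) < 2 ^ w := by
    have h1 : a * n ≤ B * B := Nat.mul_le_mul (by omega) (by omega)
    have h2 : B * B * 16 ≤ B ^ 6 := by
      calc B * B * 16 ≤ B * B * B ^ 2 := Nat.mul_le_mul_left _ (by nlinarith)
        _ = B ^ 4 := by ring
        _ ≤ B ^ 6 := Nat.pow_le_pow_right (by omega) (by omega)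
    have h3 : 0 < B * B := by positivity
    omega
  -- it suffices to be correct for the given approximations of the parameters
  suffices h : ∃ T : ℕ, (T : ℝ) ≤ (4000 : ℕ) * (r * n * Real.log (1 / δ) +
      K * Real.log (n + 1) + 1) ∧ WordRAM.Good w X Y (WordRAM.correctStates X Y ((a : ℝ) / b)) T
        (1 - (c : ℝ) / d)
        ([WordRAM.matchingProgram], WordRAM.init w [n, K, a, b, c, d]) by
    obtain ⟨T, hT, hhalt, hgood⟩ := h
    refine ⟨T, hT, hhalt, (ENNReal.ofReal_le_ofReal (by linarith)).trans (hgood.trans ?_)⟩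
    refine MeasureTheory.measure_mono fun cfg hcfg => ?_
    change (WordRAM.answer K cfg.2).Correct X Y ((a : ℝ) / b) at hcfg
    change (WordRAM.answer K cfg.2).Correct X Y r
    cases hans : WordRAM.answer K cfg.2 with
    | close s =>
      rw [hans] at hcfg
      obtain ⟨hs, hle⟩ := hcfg
      exact ⟨hs, hle.trans (one_div_le_one_div_of_le hr hra)⟩
    | far =>
      rw [hans] at hcfg
      exact hcfg
  have hinit : ∀ v ≤ B, v % 2 ^ w = v := fun v hv => Nat.mod_eq_of_lt (by omega)
  have hstart : ∀ (T : ℕ) (v : ℝ),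
      (∀ σ : WordRAM.State, σ.reg 0 = n → σ.reg 1 = K → σ.reg 2 = a → σ.reg 3 = b → σ.reg 4 = c →
        σ.reg 5 = d → σ.reg 6 = 1 → (σ.reg 14 = if b < a * n then 1 else 0) →
        WordRAM.Good w X Y (WordRAM.correctStates X Y ((a : ℝ) / b)) T v
          ([.branch 14 WordRAM.mainProgram (WordRAM.block (.const 0 1) [.const 1 0])], σ)) →
      WordRAM.Good w X Y (WordRAM.correctStates X Y ((a : ℝ) / b)) (T + 5 + 1) v
        ([WordRAM.matchingProgram], WordRAM.init w [n, K, a, b, c, d]) := by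
    intro T v h
    refine WordRAM.Good.of_step (c' := (_ :: _ :: [], _)) rfl ?_
    refine WordRAM.RunsTo.block (Post := fun σ => σ.reg 0 = n ∧ σ.reg 1 = K ∧ σ.reg 2 = a ∧
      σ.reg 3 = b ∧ σ.reg 4 = c ∧ σ.reg 5 = d ∧ σ.reg 6 = 1 ∧
      σ.reg 14 = if b < a * n then 1 else 0) ?_ _ _ _ _
      fun σ ⟨h0, h1, h2, h3, h4, h5, h6, h14⟩ => h σ h0 h1 h2 h3 h4 h5 h6 h14
    simp only [WordRAM.wp, WordRAM.State.set_reg, WordRAM.BinOp.eval, Nat.reduceEqDiff, reduceIte,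
      WordRAM.init, List.getD_cons_zero, List.getD_cons_succ, hinit n (by omega),
      hinit K (by omega), hinit a (by omega), hinit b (by omega), hinit c (by omega),
      hinit d (by omega)]
    refine ⟨by omega, by omega, by split_ifs <;> omega, ?_⟩
    simp
  by_cases hbn : b < a * n
  · have hn : 0 < n := Nat.pos_of_ne_zero (by rintro rfl; omega)
    obtain ⟨k, hk, hkd, hkmin⟩ := WordRAM.exists_min_pow (d := d) hc
    have hq : WordRAM.sampleCount n a b c d k =
      (WordRAM.sampleCount n a b c d k - 1) + 1 := by rw [WordRAM.sampleCount, Nat.add_sub_cancel]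
    generalize WordRAM.sampleCount n a b c d k - 1 = q at hq
    refine ⟨_, WordRAM.time_le (K := K) hr hδ hδ1 hb har hc hcd hδc hbn hkmin hq, ?_⟩
    refine (hstart _ _ fun σ h0 h1 h2 h3 h4 h5 h6 h14 => WordRAM.Good.of_step
      (c' := ([WordRAM.mainProgram], σ)) (by simp [WordRAM.step, h14, hbn])
      (WordRAM.good_main le_rfl hB4 hw hlin hk hkd hkmin hq
        (WordRAM.sampleBound ha hb hn hc hcd hk hq) rfl hr' h0 h1 h2 h3 h4 h5 h6)).mono
      (by omega) le_rfl
  -- Here `n ≤ b / a`, so position `0`, that is the shift `-K`, is always acceptable. The answer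
  -- takes constant time.
  · refine ⟨10, ?_, ?_⟩
    · have h1 : 0 ≤ Real.log (1 / δ) := Real.log_nonneg (by rw [le_div_iff₀ hδ]; linarith)
      have h2 : 0 ≤ Real.log ((n : ℝ) + 1) :=
        Real.log_nonneg (by linarith [Nat.cast_nonneg (α := ℝ) n])
      have h3 : 0 ≤ r * n * Real.log (1 / δ) := by positivity
      have h4 : 0 ≤ (K : ℝ) * Real.log (n + 1) := by positivity
      push_cast
      linarith
    · refine (hstart 4 _ fun σ h0 h1 h2 h3 h4 h5 h6 h14 => WordRAM.Good.of_step
        (c' := ([WordRAM.block (.const 0 1) [.const 1 0]], σ))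
        (by simp [WordRAM.step, h14, hbn]) ?_).mono le_rfl le_rfl
      refine WordRAM.RunsTo.block (Post := fun σ => σ.reg 0 ≠ 0 ∧ σ.reg 1 = 0) ?_ _ 0 _ []
        fun σ' hσ' => WordRAM.Good.halt 0 (by linarith) fun _ =>
          WordRAM.mem_correctStates_close (t := 0) hσ'.1 hσ'.2 (by omega) ?_
      · simp only [WordRAM.wp, WordRAM.State.set_reg, Nat.reduceEqDiff, reduceIte]
        exact ⟨by omega, by omega, one_ne_zero, trivial⟩
      · have hcard : (WordRAM.mismatches X Y n 0).card ≤ n :=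
          (Finset.card_filter_le _ _).trans_eq (Finset.card_range n)
        have h7 : ((WordRAM.mismatches X Y n 0).card : ℝ) ≤ n := by exact_mod_cast hcard
        refine h7.trans ?_
        have h8 : (a : ℝ) * n ≤ b := by exact_mod_cast not_lt.1 hbn
        rw [one_div_div, le_div_iff₀ (by exact_mod_cast ha), mul_comm]
        exact h8
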